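/- All graphs are finite and simple. A *module* of a graph $G$ is a set $M\subseteq V(G)$ all of whose vertices have the same neighbours in $V(G)\setminus M$; $G$ is *prime* if its only nonempty modules are $V(G)$ and the singletons $\{v\}$. For a partition $(A,B)$ of the vertex set of a graph put $\tilde A=A\cap N(B)$ and $\tilde B=B\cap N(A)$; $(A,B)$ is a *split* if every vertex of $\tilde A$ is adjacent to every vertex of $\tilde B$, and it is *proper* if $|A|,|B|\ge 2$. A *split decomposition* of $G$ is obtained from $G$ by repeatedly replacing a component $K$ by two components $K_A$ and $K_B$, where $(A,B)$ is a proper split of $K$: $K_A$ consists of $K[A]$ and a new marker vertex adjacent exactly to $\tilde A$, $K_B$ consists of $K[B]$ and a new marker vertex adjacent exactly to $\tilde B$, and the two new markers are joined by a *special edge*. The vertices of $G$ lying *behind* a marker $c$ are those on the other side of the special edge at $c$; every special edge $s$ thus defines a proper split $(X,Y)$ of $G$. A vertex $c$ of a component *stands for* the set $R(c)\subseteq V(G)$, where $R(c)=\{c\}$ if $c\in V(G)$, and, if $c$ is a marker, $R(c)$ is the set of the vertices behind $c$ that have a neighbour in $G$ not behind $c$. A *skeleton* of $G$ is a split decomposition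 of $G$ in which every component is a complete graph, a star, or has no proper split, and in which no special edge joins two complete components, nor two star components via the centre of one and a leaf of the other. The bilabeling of a set $X\subseteq V(G)$ gives one label to the vertices in $X$ and another one to those in $V(G)\setminus X$; a trilabeling $X,Y,V(G)\setminus(X\cup Y)$ uses three different labels for its three sets. Given a skeleton of $G$, let $LabG$ be the set of the following labelings of $G$: 1. for every $v\in V(G)$, the bilabeling of $\{v\}$ and the bilabeling of $\{x\in N(v) : N[x]\subseteq N[v]\}$; 2. for every special edge, defining the split $(X,Y)$ (with its sides named in an arbitrary order), the trilabeling $\tilde X,\ \tilde Y,\ V(G)\setminus(\tilde X\cup\tilde Y)$; 3. for every complete component $C$, the bilabeling of $\bigcup_{c\in C}R(c)$; 4. for every star component whose centre $c$ is a marker, the bilabeling of $R(c)$. For graphs $G,H$ with skeletons, write $LabG\equiv LabH$ if there is a bijection $g:LabG\to LabH$ such that for every $A\in LabG$ there are a graph isomorphism $f:G\to H$ and a bijection $\pi$ from the set of labels used by $A$ to the set of labels used by $g(A)$ such that for every $x\in V(G)$, if $x$ has label $i$ in $A$, then $f(x)$ has label $\pi(i)$ in $g(A)$. **Theorem.** Let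 $G$ and $H$ be prime graphs, and let $LabG$ and $LabH$ be formed from any skeleton of $G$ and any skeleton of $H$. Then $LabG\equiv LabH$ if and only if $G\cong H$. -/

import Mathlib

/-! ### Prime graphs -/

/-- `M` is a module of `G`: all vertices of `M` have the same neighbours outside `M`. -/
def SimpleGraph.IsModuleSet {V : Type*} (G : SimpleGraph V) (M : Set V) : Prop :=
  ∀ x ∈ M, ∀ y ∈ M, ∀ z, z ∉ M → (G.Adj x z ↔ G.Adj y z)

/-- `G` is prime (for modular decomposition): its only nonempty modules are `V(G)` and the
one-element sets. -/
def SimpleGraph.IsPrimeGraph {V : Type*} (G : SimpleGraph V) : Prop :=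
  ∀ M : Set V, M.Nonempty → G.IsModuleSet M → M = Set.univ ∨ ∃ v, M = {v}

/-! ### Splits -/

/-- For a vertex partition `(A, B)` this is `Ã = A ∩ N(B)`. -/
def frontierPart {α : Type*} (Adj : α → α → Prop) (A B : Set α) : Set α :=
  {a | a ∈ A ∧ ∃ b ∈ B, Adj a b}

/-- `(A, B)` is a partition of the vertex set of the graph `K` such that `Ã` and `B̃` form a
biclique. -/
def SimpleGraph.Subgraph.IsSplit {α : Type*} {Γ : SimpleGraph α} (K : Γ.Subgraph)
    (A B : Set α) : Prop :=
  A ∪ B = K.verts ∧ Disjoint A B ∧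
    ∀ a ∈ frontierPart K.Adj A B, ∀ b ∈ frontierPart K.Adj B A, K.Adj a b

/-- A split is proper if both of its sides have at least two elements. -/
def SimpleGraph.Subgraph.IsProperSplit {α : Type*} {Γ : SimpleGraph α} (K : Γ.Subgraph)
    (A B : Set α) : Prop :=
  K.IsSplit A B ∧ A.Nontrivial ∧ B.Nontrivial

/-- `K` is a complete graph. -/
def SimpleGraph.Subgraph.IsCompleteComponent {α : Type*} {Γ : SimpleGraph α} (K : Γ.Subgraph) :
    Prop :=
  ∀ x ∈ K.verts, ∀ y ∈ K.verts, x ≠ y → K.Adj x y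

/-- `K` is a star with centre `c`. -/
def SimpleGraph.Subgraph.IsStarWithCenter {α : Type*} {Γ : SimpleGraph α} (K : Γ.Subgraph)
    (c : α) : Prop :=
  c ∈ K.verts ∧
    ∀ x ∈ K.verts, ∀ y ∈ K.verts, (K.Adj x y ↔ x ≠ y ∧ (x = c ∨ y = c))

/-! ### Split decompositions and skeletons

The components of a split decomposition of a graph on `V` are graphs whose vertices are the
vertices of `V` together with new marker vertices.  We name the vertices of components by subsets
of `V`: an original vertex `v` is named `{v}`, and a marker vertex is named by the set of original
vertices that lie behind it, i.e. on the other side of its special edge. Marker names have at least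
two elements, so that no marker is confused with an original vertex. -/

/-- A finite simple graph whose vertices are named by subsets of `V`. -/
abbrev SplitComponent (V : Type*) := (⊤ : SimpleGraph (Set V)).Subgraph

/-- A vertex of a component is a marker (a special vertex) if it is not an original vertex. -/
def IsMarker {V : Type*} (P : Set V) : Prop := P.Nontrivial

/-- The graph `G` itself, as a component without markers. -/
def SimpleGraph.toSplitComponent {V : Type*} (G : SimpleGraph V) : SplitComponent V where
  verts := Set.range fun v : V => ({v} : Set V)
  Adj P Q := ∃ u v, P = {u} ∧ Q = {v} ∧ G.Adj u v
  adj_sub := by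
    rintro P Q ⟨u, v, rfl, rfl, h⟩
    simpa using h.ne
  edge_vert := by
    rintro P Q ⟨u, v, rfl, rfl, h⟩
    exact ⟨u, rfl⟩
  symm := ⟨by
    rintro P Q ⟨u, v, rfl, rfl, h⟩
    exact ⟨v, u, rfl, rfl, h.symm⟩⟩

/-- The first half `K_A` of the decomposition of the component `K` by the split `(A, B)`:
the subgraph of `K` induced by `A`, plus one new marker `⋃₀ B`, which is adjacent exactly to the
elements of `Ã`. (The second half is `splitHalf K B A`.) -/
def splitHalf {V : Type*} (K : SplitComponent V) (A B : Set (Set V)) : SplitComponent V where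
  verts := insert (⋃₀ B) A
  Adj P Q := P ≠ Q ∧
    ((P ∈ A ∧ Q ∈ A ∧ K.Adj P Q) ∨
      (P ∈ frontierPart K.Adj A B ∧ Q = ⋃₀ B) ∨ (P = ⋃₀ B ∧ Q ∈ frontierPart K.Adj A B))
  adj_sub := by
    rintro P Q ⟨h, -⟩
    simpa using h
  edge_vert := by
    rintro P Q ⟨-, h | h | h⟩
    · exact Or.inr h.1
    · exact Or.inr h.1.1
    · exact Or.inl h.1
  symm := ⟨by
    rintro P Q ⟨hne, h | h | h⟩
    · exact ⟨hne.symm, Or.inl ⟨h.2.1, h.1, h.2.2.symm⟩⟩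
    · exact ⟨hne.symm, Or.inr (Or.inr ⟨h.2, h.1⟩)⟩
    · exact ⟨hne.symm, Or.inr (Or.inl ⟨h.2, h.1⟩)⟩⟩

/-- A collection of components together with special edges. The special edge recorded as `(X, Y)`
joins the marker named `Y` (in the component on the side of `X`) with the marker named `X` (in the
component on the side of `Y`); the split of the decomposed graph that it defines is `(X, Y)`.
Each special edge is recorded once, its two ends being listed in an arbitrary order. -/
structure MarkedDecomposition (V : Type*) where
  components : Set (SplitComponent V)
  specialEdges : Set (Set V × Set V)

/-- The split decompositions of `G`: start from `G` itself, and repeatedly replace a component `K`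
by its two halves with respect to a proper split of `K`, joining the two new markers by a special
edge. -/
inductive IsSplitDecomposition {V : Type*} (G : SimpleGraph V) : MarkedDecomposition V → Prop
  | base : IsSplitDecomposition G ⟨{G.toSplitComponent}, ∅⟩
  | step (D : MarkedDecomposition V) (hD : IsSplitDecomposition G D)
      (K : SplitComponent V) (hK : K ∈ D.components) (A B : Set (Set V))
      (hAB : K.IsProperSplit A B) :
      IsSplitDecomposition G
        ⟨(D.components \ {K}) ∪ {splitHalf K A B, splitHalf K B A},
          insert (⋃₀ A, ⋃₀ B) D.specialEdges⟩

/-- `D` is a skeleton (canonical split decomposition) of `G`: every component is complete, a star,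
or has no proper split, and no special edge is superfluous, i.e. no special edge joins two complete
components, or two stars via the centre of one and a leaf of the other (two such components could
be merged into a single complete component, respectively a single star). -/
structure IsSkeleton {V : Type*} (G : SimpleGraph V) (D : MarkedDecomposition V) : Prop where
  isSplitDecomposition : IsSplitDecomposition G D
  component : ∀ K ∈ D.components,
    K.IsCompleteComponent ∨ (∃ c, K.IsStarWithCenter c) ∨ ∀ A B, ¬ K.IsProperSplit A B
  not_complete_complete : ∀ X Y, (X, Y) ∈ D.specialEdges →
    ∀ K ∈ D.components, Y ∈ K.verts → ∀ L ∈ D.components, X ∈ L.verts →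
      ¬ (K.IsCompleteComponent ∧ L.IsCompleteComponent)
  not_center_leaf : ∀ X Y, (X, Y) ∈ D.specialEdges →
    ∀ K ∈ D.components, Y ∈ K.verts → ∀ L ∈ D.components, X ∈ L.verts →
      ∀ c d, K.IsStarWithCenter c → L.IsStarWithCenter d → (c = Y ↔ d = X)

/-! ### The labelings -/

open Classical in
/-- The bilabeling of a vertex set `X`. -/
noncomputable def bilabeling {V : Type*} (X : Set V) : V → ℕ :=
  fun v => if v ∈ X then 1 else 2

open Classical in
/-- The trilabeling `X, Y, V \ (X ∪ Y)` for disjoint vertex sets `X` and `Y`. -/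
noncomputable def trilabeling {V : Type*} (X Y : Set V) : V → ℕ :=
  fun v => if v ∈ X then 1 else if v ∈ Y then 2 else 3

/-- The set of vertices of `G` that a vertex `P` of a component stands for: an original vertex
stands for itself, and a marker with the original vertices `P` behind it stands for the elements of
`P` that have a neighbour outside `P`. -/
def SimpleGraph.represented {V : Type*} (G : SimpleGraph V) (P : Set V) : Set V :=
  {v | P = {v}} ∪ frontierPart G.Adj P Pᶜ

/-- The closed neighbourhood `N[v]`. -/
def SimpleGraph.closedNbhd {V : Type*} (G : SimpleGraph V) (v : V) : Set V :=
  insert v (G.neighborSet v)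

/-- The set of canonical bilabelings and trilabelings of `G`, read off from the skeleton `D`. -/
def labSet {V : Type*} (G : SimpleGraph V) (D : MarkedDecomposition V) : Set (V → ℕ) :=
  {l | ∃ v : V, l = bilabeling {v}} ∪
  {l | ∃ v : V, l = bilabeling {x | x ∈ G.neighborSet v ∧ G.closedNbhd x ⊆ G.closedNbhd v}} ∪
  {l | ∃ X Y, (X, Y) ∈ D.specialEdges ∧
      l = trilabeling (frontierPart G.Adj X Y) (frontierPart G.Adj Y X)} ∪
  {l | ∃ C ∈ D.components, C.IsCompleteComponent ∧
      l = bilabeling (⋃ P ∈ C.verts, G.represented P)} ∪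
  {l | ∃ S ∈ D.components, ∃ c, S.IsStarWithCenter c ∧ IsMarker c ∧
      l = bilabeling (G.represented c)}

/-- The labeled graphs `(G, l)` and `(H, m)` are isomorphic via the graph isomorphism `f` and the
bijection `π` between the sets of labels that occur. -/
def IsLabeledIso {V W : Type*} {G : SimpleGraph V} {H : SimpleGraph W} (l : V → ℕ) (m : W → ℕ)
    (f : G ≃g H) (π : Set.range l ≃ Set.range m) : Prop :=
  ∀ x, (π ⟨l x, Set.mem_range_self x⟩ : ℕ) = m (f x)

/-- Equivalence of a set `LG` of labelings of `G` and a set `LH` of labelings of `H`. -/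
def LabEquivalent {V W : Type*} (G : SimpleGraph V) (H : SimpleGraph W)
    (LG : Set (V → ℕ)) (LH : Set (W → ℕ)) : Prop :=
  ∃ g : LG ≃ LH, ∀ A : LG, ∃ (f : G ≃g H) (π : Set.range A.1 ≃ Set.range (g A).1),
    IsLabeledIso A.1 (g A).1 f π

/-! One direction is immediate: the set of canonical labelings is never empty, and a single matched
labeling already carries a graph isomorphism. For the other direction the labelings must not depend
on the chosen skeleton. Every component of a split decomposition is a quotient of `G`: its vertices
partition `V` into sides of splits, and two of them are adjacent iff `G` has an edge between them
(`IsQuotient`). Such a component is determined by its vertex set. It remains to characterise the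
special edges and these vertex sets without reference to the decomposition. The special edges are
exactly the strong splits, those crossed by no split (`IsSkeleton.mem_sides_iff`). Suppose a split
`Z` crosses the special edge `X` and no other. The four corners of `X` and `Z` form a complete graph
or a star as quotient, so the components at the two ends of `X` are both complete, or are stars
joined via a centre and a leaf; a skeleton forbids both. If `Z` crosses further special edges, it is
uncrossed from one of them, and induction applies. Conversely, a strong split that is not a special
edge would split a complete or star component, where it is crossed by another split. The components
then correspond to the partitions `SimpleGraph.IsNode`, defined by strong splits alone. Hence
isomorphisms preserve all bilabelings, and preserve the trilabelings up to the arbitrary order of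
the two sides. That ambiguity is repaired by swapping the labels 1 and 2. Primality supplies
connectedness, and a vertex with the third label in each trilabeling, so that no trilabeling is
mistaken for a bilabeling. -/

/-! ### Splits as vertex sets, and crossing splits -/

/-- `(X, Xᶜ)` is a (possibly improper) split of `G`. -/
def SimpleGraph.IsSplitSet {V : Type*} (G : SimpleGraph V) (X : Set V) : Prop :=
  ∀ a ∈ X, ∀ a' ∈ X, ∀ b ∉ X, ∀ b' ∉ X, G.Adj a b → G.Adj a' b' → G.Adj a b'

/-- The bipartitions `(X, Xᶜ)` and `(Z, Zᶜ)` cross. -/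
def Crosses {V : Type*} (X Z : Set V) : Prop :=
  (X ∩ Z).Nonempty ∧ (X ∩ Zᶜ).Nonempty ∧ (Xᶜ ∩ Z).Nonempty ∧ (Xᶜ ∩ Zᶜ).Nonempty

/-- `(X, Xᶜ)` is a proper split that is crossed by no split. -/
structure SimpleGraph.IsStrongSplit {V : Type*} (G : SimpleGraph V) (X : Set V) : Prop where
  isSplitSet : G.IsSplitSet X
  nontrivial : X.Nontrivial
  compl_nontrivial : Xᶜ.Nontrivial
  not_crosses : ∀ Z, G.IsSplitSet Z → ¬ Crosses X Z

/-- There is an edge between `S` and `T`. -/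
def SimpleGraph.Touches {V : Type*} (G : SimpleGraph V) (S T : Set V) : Prop :=
  ∃ u ∈ S, ∃ v ∈ T, G.Adj u v

/-- Every nontrivial vertex bipartition has an edge across it. -/
def SimpleGraph.CutConnected {V : Type*} (G : SimpleGraph V) : Prop :=
  ∀ M : Set V, M.Nonempty → Mᶜ.Nonempty → G.Touches M Mᶜ

section Basic

variable {V : Type*} {G : SimpleGraph V} {X Z P F S T : Set V}

lemma SimpleGraph.Touches.symm (h : G.Touches S T) : G.Touches T S := by
  obtain ⟨u, hu, v, hv, h⟩ := h
  exact ⟨v, hv, u, hu, h.symm⟩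

lemma SimpleGraph.touches_comm : G.Touches S T ↔ G.Touches T S :=
  ⟨fun h => h.symm, fun h => h.symm⟩

lemma SimpleGraph.IsSplitSet.compl (h : G.IsSplitSet X) : G.IsSplitSet Xᶜ := by
  intro a ha a' ha' b hb b' hb' hab hab'
  exact (h b' (not_not.1 hb') b (not_not.1 hb) a' ha' a ha hab'.symm hab.symm).symm

lemma SimpleGraph.isSplitSet_singleton (v : V) : G.IsSplitSet {v} := by
  rintro a rfl a' rfl b - b' - - h
  exact h

lemma Crosses.symm (h : Crosses X Z) : Crosses Z X := by
  obtain ⟨h1, h2, h3, h4⟩ := h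
  simp only [Crosses, Set.inter_comm Z, Set.inter_comm Zᶜ]
  exact ⟨h1, h3, h2, h4⟩

lemma Crosses.compl_left (h : Crosses X Z) : Crosses Xᶜ Z := by
  obtain ⟨h1, h2, h3, h4⟩ := h
  simp only [Crosses, compl_compl]
  exact ⟨h3, h4, h1, h2⟩

lemma Crosses.compl_right (h : Crosses X Z) : Crosses X Zᶜ := h.symm.compl_left.symm

lemma SimpleGraph.IsStrongSplit.compl (h : G.IsStrongSplit X) : G.IsStrongSplit Xᶜ where
  isSplitSet := h.isSplitSet.compl
  nontrivial := h.compl_nontrivial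
  compl_nontrivial := by simpa using h.nontrivial
  not_crosses Z hZ hc := h.not_crosses Z hZ (by have := hc.compl_left; rwa [compl_compl] at this)

/-- A prime graph with a proper split is connected. -/
lemma SimpleGraph.IsPrimeGraph.cutConnected (hG : G.IsPrimeGraph) (hX : X.Nontrivial)
    (hXc : Xᶜ.Nontrivial) : G.CutConnected := by
  intro M hM hMc
  by_contra hno
  have h : ∀ a ∈ M, ∀ b ∉ M, ¬ G.Adj a b := fun a ha b hb hab => hno ⟨a, ha, b, hb, hab⟩
  -- Without edges across, `M` and its complement are both modules, hence singletons; but a proper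
  -- split needs four vertices.
  have h1 : G.IsModuleSet M := fun x hx y hy z hz => by simp [h x hx z hz, h y hy z hz]
  have h2 : G.IsModuleSet Mᶜ := fun x hx y hy z hz => by
    have hz := not_not.1 hz
    exact iff_of_false (fun e => h z hz x hx e.symm) fun e => h z hz y hy e.symm
  obtain ⟨b, hb⟩ := hMc
  rcases hG M hM h1 with h3 | ⟨v, h3⟩
  · exact hb (h3 ▸ Set.mem_univ b)
  rcases hG Mᶜ ⟨b, hb⟩ h2 with h4 | ⟨w, h4⟩
  · exact hM.ne_empty (by simpa using h4)
  have key : ∀ x, x = v ∨ x = w := fun x => by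
    by_cases hx : x ∈ M
    · left; simpa [h3] using hx
    · right
      have : x ∈ Mᶜ := hx
      simpa [h4] using this
  obtain ⟨x, hx, y, hy, hxy⟩ := hX
  obtain ⟨z, hz, t, ht, hzt⟩ := hXc
  have e1 : x ≠ z := fun e => hz (e ▸ hx)
  have e2 : y ≠ z := fun e => hz (e ▸ hy)
  rcases key x with rfl | rfl <;> rcases key y with rfl | rfl <;> rcases key z with rfl | rfl <;>
    simp_all

/-- In a connected graph the intersection of two crossing splits is a split. -/
lemma SimpleGraph.IsSplitSet.inter (hG : G.CutConnected) (hX : G.IsSplitSet X)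
    (hZ : G.IsSplitSet Z) (hc : Crosses X Z) : G.IsSplitSet (X ∩ Z) := by
  -- The only hard case: the two outer endpoints lie in different mixed corners. Connectedness gives
  -- an edge leaving the corner opposite to `X ∩ Z`, and the two splits reroute it to a neighbour
  -- `r` of `p` in that corner; then `Z` carries `p r` and `p' q'` to `p q'`.
  have main : ∀ X Z : Set V, G.IsSplitSet X → G.IsSplitSet Z → Crosses X Z →
      ∀ p ∈ X ∩ Z, ∀ p' ∈ X ∩ Z, ∀ q ∈ Xᶜ ∩ Z, ∀ q' ∈ X ∩ Zᶜ, G.Adj p q → G.Adj p' q' →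
        G.Adj p q' := by
    intro X Z hX hZ hc p hp p' hp' q hq q' hq' h h'
    have hout : ∃ r, r ∉ X ∧ r ∉ Z ∧ G.Adj p r := by
      obtain ⟨r, hr, s, hs, hrs⟩ := hG (Xᶜ ∩ Zᶜ) hc.2.2.2 ⟨p, fun h => h.1 hp.1⟩
      refine ⟨r, hr.1, hr.2, ?_⟩
      by_cases hsX : s ∈ X
      · exact hX p hp.1 s hsX q hq.1 r hr.1 h hrs.symm
      · have hsZ : s ∈ Z := by
          by_contra hsZ
          exact hs ⟨hsX, hsZ⟩
        have h3 : G.Adj p' r := hZ p' hp'.2 s hsZ q' hq'.2 r hr.2 h' hrs.symm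
        exact hX p hp.1 p' hp'.1 q hq.1 r hr.1 h h3
    obtain ⟨r, hrX, hrZ, hpr⟩ := hout
    exact hZ p hp.2 p' hp'.2 r hrZ q' hq'.2 hpr h'
  intro p hp p' hp' q hq q' hq' h h'
  by_cases hqX : q ∈ X
  · have hqZ : q ∉ Z := fun hqZ => hq ⟨hqX, hqZ⟩
    by_cases hqZ' : q' ∈ Z
    · have hqX' : q' ∉ X := fun hqX' => hq' ⟨hqX', hqZ'⟩
      exact main Z X hZ hX hc.symm p hp.symm p' hp'.symm q ⟨hqZ, hqX⟩ q' ⟨hqZ', hqX'⟩ h h'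
    · exact hZ p hp.2 p' hp'.2 q hqZ q' hqZ' h h'
  · by_cases hqX' : q' ∈ X
    · have hqZ' : q' ∉ Z := fun hqZ' => hq' ⟨hqX', hqZ'⟩
      by_cases hqZ : q ∈ Z
      · exact main X Z hX hZ hc p hp p' hp' q ⟨hqX, hqZ⟩ q' ⟨hqX', hqZ'⟩ h h'
      · exact hZ p hp.2 p' hp'.2 q hqZ q' hqZ' h h'
    · exact hX p hp.1 p' hp'.1 q hqX q' hqX' h h'

/-- Replacing a split `Z` by its union with a crossing split creates no new crossings. -/
lemma not_crosses_union (hc : Crosses P Z) (h1 : ¬ Crosses F Z) (h2 : ¬ Crosses F P) :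
    ¬ Crosses F (Z ∪ P) := by
  have key : ∀ F : Set V, ¬ Crosses F P → F ⊆ Z ∨ F ⊆ Zᶜ → ¬ Crosses F (Z ∪ P) := by
    rintro F h2 (h | h) ⟨⟨w, hw⟩, ⟨x, hx⟩, -, -⟩
    · exact hx.2 (Or.inl (h hx.1))
    · obtain ⟨⟨a, ha⟩, -, ⟨c, hc⟩, -⟩ := hc
      refine h2 ⟨⟨w, hw.1, hw.2.resolve_left (h hw.1)⟩, ⟨x, hx.1, fun e => hx.2 (Or.inr e)⟩,
        ⟨a, fun e => h e ha.2, ha.1⟩, ⟨c, fun e => h e hc.2, hc.1⟩⟩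
  -- As `F` and `Z` do not cross, `F` or its complement lies on one side of `Z`.
  by_cases hF : F ⊆ Z ∨ F ⊆ Zᶜ
  · exact key F h2 hF
  · intro hcr
    refine key Fᶜ (fun h => h2 (by simpa using h.compl_left)) ?_ hcr.compl_left
    by_contra hF'
    simp only [not_or, Set.not_subset] at hF hF'
    obtain ⟨⟨x, hx⟩, ⟨y, hy⟩⟩ := hF
    obtain ⟨⟨z, hz⟩, ⟨t, ht⟩⟩ := hF'
    simp only [Set.mem_compl_iff, not_not] at hy ht
    exact h1 ⟨⟨y, hy⟩, ⟨x, hx⟩, ⟨t, ht⟩, ⟨z, hz⟩⟩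

lemma SimpleGraph.IsSplitSet.union (hG : G.CutConnected) (hX : G.IsSplitSet X)
    (hZ : G.IsSplitSet Z) (hc : Crosses X Z) : G.IsSplitSet (X ∪ Z) := by
  have := (hX.compl.inter hG hZ.compl hc.compl_left.compl_right).compl
  rwa [Set.compl_inter, compl_compl, compl_compl] at this

/-- A split crossing both `X` and a smaller split `P` can be changed so that it still crosses `X`
but no longer `P`, without creating new crossings. -/
lemma SimpleGraph.IsSplitSet.exists_uncross (hG : G.CutConnected) (hZ : G.IsSplitSet Z)
    (hP : G.IsSplitSet P) (hXZ : Crosses X Z) (hPZ : Crosses P Z) (hPX : P ⊆ X) (hne : P ≠ X) :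
    ∃ Z', G.IsSplitSet Z' ∧ Crosses X Z' ∧ ¬ Crosses P Z' ∧
      ∀ F, ¬ Crosses F Z → ¬ Crosses F P → ¬ Crosses F Z' := by
  -- The new split is `Z ∪ P`. A point of `X` outside it is needed to keep crossing `X`; any point
  -- of `X` outside `P` serves, after replacing `Z` by its complement if necessary.
  have main : ∀ Z, G.IsSplitSet Z → Crosses X Z → Crosses P Z → (∃ x ∈ X, x ∉ Z ∧ x ∉ P) →
      ∃ Z', G.IsSplitSet Z' ∧ Crosses X Z' ∧ ¬ Crosses P Z' ∧
      ∀ F, ¬ Crosses F Z → ¬ Crosses F P → ¬ Crosses F Z' := by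
    rintro Z hZ hXZ hPZ ⟨x, hxX, hxZ, hxP⟩
    refine ⟨Z ∪ P, hZ.union hG hP hPZ.symm, ⟨?_, ?_, ?_, ?_⟩, ?_,
      fun F h1 h2 => not_crosses_union hPZ h1 h2⟩
    · exact hXZ.1.mono (by gcongr; exact Set.subset_union_left)
    · exact ⟨x, hxX, fun h => h.elim hxZ hxP⟩
    · exact hXZ.2.2.1.mono (by gcongr; exact Set.subset_union_left)
    · obtain ⟨y, hy, hyZ⟩ := hXZ.2.2.2
      exact ⟨y, hy, fun h => h.elim hyZ fun h => hy (hPX h)⟩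
    · rintro ⟨-, ⟨y, hy, hy'⟩, -⟩
      exact hy' (Or.inr hy)
  obtain ⟨x, hxX, hxP⟩ := Set.exists_of_ssubset (hPX.ssubset_of_ne hne)
  by_cases hxZ : x ∈ Z
  · obtain ⟨Z', h1, h2, h3, h4⟩ := main Zᶜ hZ.compl hXZ.compl_right hPZ.compl_right
      ⟨x, hxX, by simpa using hxZ, hxP⟩
    exact ⟨Z', h1, h2, h3, fun F hF => h4 F fun h => hF (by simpa using h.compl_right)⟩
  · exact main Z hZ hXZ hPZ ⟨x, hxX, hxZ, hxP⟩

/-! ### The four corners of two crossing splits -/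

/-- The propositional core of the corner argument. The `x` and `z` hypotheses are the biclique
conditions of the two splits, and the last four say that no corner is isolated. The outcomes are the
complete graph and the stars centred at `a`, `b`, `c`, `d`. -/
lemma complete_or_star_of_corners {ab ac ad bc bd cd : Prop} (x1 : ac → bd → ad)
    (x2 : bd → ac → bc) (x3 : ad → bc → ac) (x4 : bc → ad → bd) (z1 : ab → cd → ad)
    (z2 : cd → ab → bc) (z3 : ad → bc → ab) (z4 : bc → ad → cd) (ha : ab ∨ ac ∨ ad)
    (hb : ab ∨ bc ∨ bd) (hc : ac ∨ bc ∨ cd) (hd : ad ∨ bd ∨ cd) :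
    (ab ∧ ac ∧ ad ∧ bc ∧ bd ∧ cd) ∨ (ab ∧ ac ∧ ad ∧ ¬ bc ∧ ¬ bd ∧ ¬ cd) ∨
    (ab ∧ ¬ ac ∧ ¬ ad ∧ bc ∧ bd ∧ ¬ cd) ∨ (¬ ab ∧ ac ∧ ¬ ad ∧ bc ∧ ¬ bd ∧ cd) ∨
    (¬ ab ∧ ¬ ac ∧ ad ∧ ¬ bc ∧ bd ∧ cd) := by
  by_cases ad <;> by_cases bc <;> by_cases ab <;> grind

/-- The quotient of a connected graph by the four corners `a, b, c, d` of two crossing splits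
`(a ∪ b, c ∪ d)` and `(a ∪ c, b ∪ d)` is a complete graph or a star. -/
lemma SimpleGraph.IsSplitSet.corners (hG : G.CutConnected) (hX : G.IsSplitSet X)
    (hZ : G.IsSplitSet Z) (hc : Crosses X Z) {a b c d : Set V} (ha : a = X ∩ Z) (hb : b = X ∩ Zᶜ)
    (hc' : c = Xᶜ ∩ Z) (hd : d = Xᶜ ∩ Zᶜ) :
    (G.Touches a b ∧ G.Touches a c ∧ G.Touches a d ∧
      G.Touches b c ∧ G.Touches b d ∧ G.Touches c d) ∨
    (G.Touches a b ∧ G.Touches a c ∧ G.Touches a d ∧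
      ¬ G.Touches b c ∧ ¬ G.Touches b d ∧ ¬ G.Touches c d) ∨
    (G.Touches a b ∧ ¬ G.Touches a c ∧ ¬ G.Touches a d ∧
      G.Touches b c ∧ G.Touches b d ∧ ¬ G.Touches c d) ∨
    (¬ G.Touches a b ∧ G.Touches a c ∧ ¬ G.Touches a d ∧
      G.Touches b c ∧ ¬ G.Touches b d ∧ G.Touches c d) ∨
    (¬ G.Touches a b ∧ ¬ G.Touches a c ∧ G.Touches a d ∧
      ¬ G.Touches b c ∧ G.Touches b d ∧ G.Touches c d) := by
  have rect : ∀ Y, G.IsSplitSet Y → ∀ {s t s' t' : Set V}, s ⊆ Y → s' ⊆ Y → t ⊆ Yᶜ → t' ⊆ Yᶜ →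
      G.Touches s t → G.Touches s' t' → G.Touches s t' := by
    rintro Y hY s t s' t' hs hs' ht ht' ⟨u, hu, v, hv, huv⟩ ⟨u', hu', v', hv', huv'⟩
    exact ⟨u, hu, v', hv', hY u (hs hu) u' (hs' hu') v (ht hv) v' (ht' hv') huv huv'⟩
  have haX : a ⊆ X := ha ▸ Set.inter_subset_left
  have haZ : a ⊆ Z := ha ▸ Set.inter_subset_right
  have hbX : b ⊆ X := hb ▸ Set.inter_subset_left
  have hbZ : b ⊆ Zᶜ := hb ▸ Set.inter_subset_right
  have hcX : c ⊆ Xᶜ := hc' ▸ Set.inter_subset_left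
  have hcZ : c ⊆ Z := hc' ▸ Set.inter_subset_right
  have hdX : d ⊆ Xᶜ := hd ▸ Set.inter_subset_left
  have hdZ : d ⊆ Zᶜ := hd ▸ Set.inter_subset_right
  have cover : ∀ x, x ∈ a ∨ x ∈ b ∨ x ∈ c ∨ x ∈ d := by
    intro x
    by_cases h1 : x ∈ X <;> by_cases h2 : x ∈ Z <;> simp [ha, hb, hc', hd, h1, h2]
  have na : a.Nonempty := ha ▸ hc.1
  have nb : b.Nonempty := hb ▸ hc.2.1
  have nc : c.Nonempty := hc' ▸ hc.2.2.1
  have nd : d.Nonempty := hd ▸ hc.2.2.2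
  have x1 := rect X hX haX hbX hcX hdX
  have x2 := rect X hX hbX haX hdX hcX
  have x3 := rect X hX haX hbX hdX hcX
  have x4 := rect X hX hbX haX hcX hdX
  have z1 := rect Z hZ haZ hcZ hbZ hdZ
  have z2 := rect Z hZ hcZ haZ hdZ hbZ
  have z3 := rect Z hZ haZ hcZ hdZ hbZ
  have z4 := rect Z hZ hcZ haZ hbZ hdZ
  rw [touches_comm (S := c) (T := b)] at z2 z3 z4
  have disj : ∀ x, (x ∈ a → x ∉ b ∧ x ∉ c ∧ x ∉ d) ∧ (x ∈ b → x ∉ c ∧ x ∉ d) ∧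
      (x ∈ c → x ∉ d) := by
    intro x
    by_cases h1 : x ∈ X <;> by_cases h2 : x ∈ Z <;> simp [ha, hb, hc', hd, h1, h2]
  have cut1 : ∀ s t u w : Set V, s.Nonempty → t.Nonempty →
      (∀ x, x ∈ s ∨ x ∈ t ∨ x ∈ u ∨ x ∈ w) → (∀ x ∈ s, x ∉ t) →
      G.Touches s t ∨ G.Touches s u ∨ G.Touches s w := by
    intro s t u w hs ht hcov hdis
    obtain ⟨x, hx, y, hy, hxy⟩ := hG s hs (ht.mono fun z hz hz' => hdis z hz' hz)
    rcases hcov y with h | h | h | h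
    · exact absurd h hy
    · exact Or.inl ⟨x, hx, y, h, hxy⟩
    · exact Or.inr (Or.inl ⟨x, hx, y, h, hxy⟩)
    · exact Or.inr (Or.inr ⟨x, hx, y, h, hxy⟩)
  have ca := cut1 a b c d na nb cover fun x h => ((disj x).1 h).1
  have cb := cut1 b a c d nb na (fun x => by rcases cover x with h | h | h | h <;> simp [h])
    fun x h h' => ((disj x).1 h').1 h
  have cc := cut1 c a b d nc na (fun x => by rcases cover x with h | h | h | h <;> simp [h])
    fun x h h' => ((disj x).1 h').2.1 h
  have cd := cut1 d a b c nd na (fun x => by rcases cover x with h | h | h | h <;> simp [h])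
    fun x h h' => ((disj x).1 h').2.2 h
  rw [touches_comm (S := b) (T := a)] at cb
  rw [touches_comm (S := c) (T := a), touches_comm (S := c) (T := b)] at cc
  rw [touches_comm (S := d) (T := a), touches_comm (S := d) (T := b),
    touches_comm (S := d) (T := c)] at cd
  exact complete_or_star_of_corners x1 x2 x3 x4 z1 z2 z3 z4 ca cb cc cd

end Basic

/-! ### Components of a split decomposition are quotients -/

/-- The vertices of `K` form a partition of `V` into sides of splits of `G`, and `K` is the
corresponding quotient of `G`. -/
structure IsQuotient {V : Type*} (G : SimpleGraph V) (K : SplitComponent V) : Prop where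
  nonempty : ∀ P ∈ K.verts, P.Nonempty
  cover : ∀ v, ∃ P ∈ K.verts, v ∈ P
  eq_of_mem : ∀ P ∈ K.verts, ∀ Q ∈ K.verts, ∀ v ∈ P, v ∈ Q → P = Q
  isSplitSet : ∀ P ∈ K.verts, G.IsSplitSet P
  adj_iff : ∀ P Q, K.Adj P Q ↔ P ∈ K.verts ∧ Q ∈ K.verts ∧ P ≠ Q ∧ G.Touches P Q

section Quotient

variable {V : Type*} {G : SimpleGraph V} {K : SplitComponent V} {A B : Set (Set V)}

lemma isQuotient_toSplitComponent (G : SimpleGraph V) : IsQuotient G G.toSplitComponent where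
  nonempty := by
    rintro _ ⟨v, rfl⟩
    exact Set.singleton_nonempty v
  cover v := ⟨{v}, ⟨v, rfl⟩, rfl⟩
  eq_of_mem := by
    rintro _ ⟨v, rfl⟩ _ ⟨w, rfl⟩ u rfl h
    exact congrArg _ h
  isSplitSet := by
    rintro _ ⟨v, rfl⟩
    exact SimpleGraph.isSplitSet_singleton v
  adj_iff P Q := by
    constructor
    · rintro ⟨u, v, rfl, rfl, h⟩
      exact ⟨⟨u, rfl⟩, ⟨v, rfl⟩, by simpa using h.ne, u, rfl, v, rfl, h⟩
    · rintro ⟨⟨u, rfl⟩, ⟨v, rfl⟩, -, _, rfl, _, rfl, h⟩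
      exact ⟨_, _, rfl, rfl, h⟩

namespace IsQuotient

lemma compl_sUnion (hK : IsQuotient G K) (hAB : A ∪ B = K.verts) (hd : Disjoint A B) :
    (⋃₀ A)ᶜ = ⋃₀ B := by
  ext v
  constructor
  · intro hv
    obtain ⟨P, hP, hvP⟩ := hK.cover v
    rw [← hAB] at hP
    exact hP.elim (fun h => absurd ⟨P, h, hvP⟩ hv) fun h => ⟨P, h, hvP⟩
  · rintro ⟨P, hP, hvP⟩ ⟨Q, hQ, hvQ⟩
    have : P = Q := hK.eq_of_mem P (hAB ▸ Or.inr hP) Q (hAB ▸ Or.inl hQ) v hvP hvQ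
    exact Set.disjoint_left.1 hd hQ (this ▸ hP)

lemma mem_of_mem_sUnion (hK : IsQuotient G K) (hA : A ⊆ K.verts) {P : Set V} (hP : P ∈ K.verts)
    {v : V} (hv : v ∈ P) (hvA : v ∈ ⋃₀ A) : P ∈ A := by
  obtain ⟨Q, hQ, hvQ⟩ := hvA
  rwa [hK.eq_of_mem P hP Q (hA hQ) v hv hvQ]

lemma sUnion_nontrivial (hK : IsQuotient G K) (hA : A ⊆ K.verts) (h : A.Nontrivial) :
    (⋃₀ A).Nontrivial := by
  obtain ⟨P, hP, Q, hQ, hPQ⟩ := h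
  obtain ⟨u, hu⟩ := hK.nonempty P (hA hP)
  obtain ⟨v, hv⟩ := hK.nonempty Q (hA hQ)
  refine ⟨u, ⟨P, hP, hu⟩, v, ⟨Q, hQ, hv⟩, ?_⟩
  rintro rfl
  exact hPQ (hK.eq_of_mem P (hA hP) Q (hA hQ) u hu hv)

/-- The split of `K` yields some edge `u w` of `G` between the two parts concerned. Since each part
is itself a side of a split of `G`, the endpoints of that edge can be exchanged for the desired
ones, one part at a time. -/
lemma isSplitSet_sUnion (hK : IsQuotient G K) (h : K.IsSplit A B) : G.IsSplitSet (⋃₀ A) := by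
  obtain ⟨hAB, hd, hs⟩ := h
  have hA : A ⊆ K.verts := hAB ▸ Set.subset_union_left
  have hB : B ⊆ K.verts := hAB ▸ Set.subset_union_right
  have hcompl := hK.compl_sUnion hAB hd
  rintro a ⟨P, hP, haP⟩ a' ⟨P', hP', haP'⟩ b hb b' hb' hab hab'
  rw [← Set.mem_compl_iff, hcompl] at hb hb'
  obtain ⟨Q, hQ, hbQ⟩ := hb
  obtain ⟨Q', hQ', hbQ'⟩ := hb'
  have hne : ∀ P ∈ A, ∀ Q ∈ B, P ≠ Q := fun P hP Q hQ e =>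
    Set.disjoint_left.1 hd hP (e ▸ hQ)
  have adj : ∀ P ∈ A, ∀ Q ∈ B, ∀ a ∈ P, ∀ b ∈ Q, G.Adj a b → K.Adj P Q :=
    fun P hP Q hQ a ha b hb h => (hK.adj_iff P Q).2 ⟨hA hP, hB hQ, hne P hP Q hQ, a, ha, b, hb, h⟩
  have h1 := hs P ⟨hP, Q, hQ, adj P hP Q hQ a haP b hbQ hab⟩ Q'
    ⟨hQ', P', hP', (adj P' hP' Q' hQ' a' haP' b' hbQ' hab').symm⟩
  obtain ⟨-, -, -, u, hu, w, hw, huw⟩ := (hK.adj_iff P Q').1 h1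
  have notMem : ∀ P ∈ A, ∀ Q ∈ B, ∀ v ∈ P, v ∉ Q := fun P hP Q hQ v hv hv' =>
    hne P hP Q hQ (hK.eq_of_mem P (hA hP) Q (hB hQ) v hv hv')
  have haw : G.Adj a w := hK.isSplitSet P (hA hP) a haP u hu b
    (fun h => notMem P hP Q hQ b h hbQ) w (fun h => notMem P hP Q' hQ' w h hw) hab huw
  exact (hK.isSplitSet Q' (hB hQ')).compl a (notMem P hP Q' hQ' a haP) a'
    (notMem P' hP' Q' hQ' a' haP') w (not_not.2 hw) b' (not_not.2 hbQ') haw hab'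

lemma isSplit_of_isSplitSet (hK : IsQuotient G K) (hAB : A ∪ B = K.verts) (hd : Disjoint A B)
    (h : G.IsSplitSet (⋃₀ A)) : K.IsSplit A B := by
  refine ⟨hAB, hd, ?_⟩
  have hcompl := hK.compl_sUnion hAB hd
  rintro P ⟨hP, Q, hQ, hPQ⟩ Q' ⟨hQ', P', hP', hPQ'⟩
  obtain ⟨h1, -, -, u, hu, w, hw, huw⟩ := (hK.adj_iff P Q).1 hPQ
  obtain ⟨h2, -, -, w', hw', u', hu', huw'⟩ := (hK.adj_iff Q' P').1 hPQ'
  have out : ∀ Q ∈ B, ∀ w ∈ Q, w ∉ ⋃₀ A := fun Q hQ w hw => by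
    rw [← Set.mem_compl_iff, hcompl]
    exact ⟨Q, hQ, hw⟩
  refine (hK.adj_iff P Q').2 ⟨h1, h2, fun e => Set.disjoint_left.1 hd hP (e ▸ hQ'), u, hu, w', hw',
    h u ⟨P, hP, hu⟩ u' ⟨P', hP', hu'⟩ w (out Q hQ w hw) w' (out Q' hQ' w' hw') huw huw'.symm⟩

lemma sUnion_notMem (hK : IsQuotient G K) (hAB : A ∪ B = K.verts) (hd : Disjoint A B)
    (hB : B.Nonempty) : ⋃₀ B ∉ A := by
  intro h
  obtain ⟨Q, hQ⟩ := hB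
  obtain ⟨v, hv⟩ := hK.nonempty Q (hAB ▸ Or.inr hQ)
  have hA : A ⊆ K.verts := hAB ▸ Set.subset_union_left
  have := hK.eq_of_mem _ (hA h) Q (hAB ▸ Or.inr hQ) v ⟨Q, hQ, hv⟩ hv
  exact Set.disjoint_left.1 hd h (this ▸ hQ)

lemma splitHalf (hK : IsQuotient G K) (h : K.IsSplit A B) (hB : B.Nonempty) :
    IsQuotient G (splitHalf K A B) := by
  obtain ⟨hAB, hd, hs⟩ := id h
  have hA : A ⊆ K.verts := hAB ▸ Set.subset_union_left
  have hBK : B ⊆ K.verts := hAB ▸ Set.subset_union_right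
  have hcompl := hK.compl_sUnion hAB hd
  have hnot : ∀ P ∈ A, ∀ v ∈ P, v ∉ ⋃₀ B := fun P hP v hv hvB => by
    rw [← hcompl] at hvB
    exact hvB ⟨P, hP, hv⟩
  have hfront : ∀ P, P ∈ frontierPart K.Adj A B ↔ P ∈ A ∧ G.Touches P (⋃₀ B) := by
    intro P
    constructor
    · rintro ⟨hP, Q, hQ, hPQ⟩
      obtain ⟨-, -, -, u, hu, w, hw, huw⟩ := (hK.adj_iff P Q).1 hPQ
      exact ⟨hP, u, hu, w, ⟨Q, hQ, hw⟩, huw⟩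
    · rintro ⟨hP, u, hu, w, ⟨Q, hQ, hw⟩, huw⟩
      exact ⟨hP, Q, hQ, (hK.adj_iff P Q).2
        ⟨hA hP, hBK hQ, fun e => Set.disjoint_left.1 hd hP (e ▸ hQ), u, hu, w, hw, huw⟩⟩
  refine ⟨?_, ?_, ?_, ?_, ?_⟩
  · rintro P (rfl | hP)
    · obtain ⟨Q, hQ⟩ := hB
      obtain ⟨v, hv⟩ := hK.nonempty Q (hBK hQ)
      exact ⟨v, Q, hQ, hv⟩
    · exact hK.nonempty P (hA hP)
  · intro v
    by_cases hv : v ∈ ⋃₀ A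
    · obtain ⟨P, hP, hvP⟩ := hv
      exact ⟨P, Or.inr hP, hvP⟩
    · rw [← Set.mem_compl_iff, hcompl] at hv
      exact ⟨⋃₀ B, Or.inl rfl, hv⟩
  · rintro P (rfl | hP) Q (rfl | hQ) v hvP hvQ
    · rfl
    · exact absurd hvP (hnot Q hQ v hvQ)
    · exact absurd hvQ (hnot P hP v hvP)
    · exact hK.eq_of_mem P (hA hP) Q (hA hQ) v hvP hvQ
  · rintro P (rfl | hP)
    · rw [← hcompl]
      exact (hK.isSplitSet_sUnion h).compl
    · exact hK.isSplitSet P (hA hP)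
  · intro P Q
    change P ≠ Q ∧ _ ↔ (P = _ ∨ P ∈ A) ∧ (Q = _ ∨ Q ∈ A) ∧ _
    simp only [hfront]
    constructor
    · rintro ⟨hne, ⟨hP, hQ, h⟩ | ⟨⟨hP, h⟩, rfl⟩ | ⟨rfl, hQ, h⟩⟩
      · exact ⟨Or.inr hP, Or.inr hQ, hne, ((hK.adj_iff P Q).1 h).2.2.2⟩
      · exact ⟨Or.inr hP, Or.inl rfl, hne, h⟩
      · exact ⟨Or.inl rfl, Or.inr hQ, hne, h.symm⟩
    · rintro ⟨rfl | hP, rfl | hQ, hne, h⟩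
      · exact absurd rfl hne
      · exact ⟨hne, Or.inr (Or.inr ⟨rfl, hQ, h.symm⟩)⟩
      · exact ⟨hne, Or.inr (Or.inl ⟨⟨hP, h⟩, rfl⟩)⟩
      · exact ⟨hne, Or.inl ⟨hP, hQ, (hK.adj_iff P Q).2 ⟨hA hP, hA hQ, hne, h⟩⟩⟩

end IsQuotient

end Quotient

/-! ### Structure of a split decomposition -/

/-- The sides of the splits defined by the special edges. -/
def MarkedDecomposition.sides {V : Type*} (D : MarkedDecomposition V) : Set (Set V) :=
  {X | (X, Xᶜ) ∈ D.specialEdges ∨ (Xᶜ, X) ∈ D.specialEdges}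

lemma MarkedDecomposition.compl_mem_sides {V : Type*} {D : MarkedDecomposition V} {X : Set V}
    (h : X ∈ D.sides) : Xᶜ ∈ D.sides := by
  simpa [sides, or_comm] using h

/-- The tree structure of a split decomposition `D` of `G`. -/
structure MarkedDecomposition.IsTreeLike {V : Type*} (G : SimpleGraph V)
    (D : MarkedDecomposition V) : Prop where
  components_nonempty : D.components.Nonempty
  isQuotient : ∀ K ∈ D.components, IsQuotient G K
  eq_compl : ∀ X Y, (X, Y) ∈ D.specialEdges → Y = Xᶜ
  asymm : ∀ X Y, (X, Y) ∈ D.specialEdges → (Y, X) ∉ D.specialEdges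
  nontrivial : ∀ X ∈ D.sides, X.Nontrivial
  singleton_or_side : ∀ K ∈ D.components, ∀ P ∈ K.verts, (∃ v, P = {v}) ∨ P ∈ D.sides
  exists_component : ∀ X ∈ D.sides, ∃ K ∈ D.components, X ∈ K.verts
  -- Seen from any component, a special edge has one whole side behind a single vertex.
  subset_vertex : ∀ X ∈ D.sides, ∀ K ∈ D.components, ∃ P ∈ K.verts, X ⊆ P ∨ Xᶜ ⊆ P
  compl_notMem : ∀ X ∈ D.sides, ∀ K ∈ D.components, X ∈ K.verts → Xᶜ ∉ K.verts
  -- The markers of two components that point towards each other in the tree.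
  covering_pair : ∀ K ∈ D.components, ∀ L ∈ D.components, K ≠ L →
    ∃ P ∈ K.verts, ∃ Q ∈ L.verts, P ∪ Q = Set.univ
  -- This is what later forces a strong split to be a special edge or to split one component.
  side_or_union : ∀ Z : Set V, Z.Nontrivial → Zᶜ.Nontrivial → (∀ X ∈ D.sides, ¬ Crosses X Z) →
    Z ∈ D.sides ∨ ∃ K ∈ D.components, ∃ A B, A ∪ B = K.verts ∧ Disjoint A B ∧
      A.Nontrivial ∧ B.Nontrivial ∧ ⋃₀ A = Z

section TreeLike

variable {V : Type*} {G : SimpleGraph V} {D : MarkedDecomposition V} {K : SplitComponent V}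
  {A B : Set (Set V)}

/-- The result of decomposing the component `K` by the split `(A, B)`. -/
def MarkedDecomposition.decompose (D : MarkedDecomposition V) (K : SplitComponent V)
    (A B : Set (Set V)) : MarkedDecomposition V :=
  ⟨(D.components \ {K}) ∪ {splitHalf K A B, splitHalf K B A},
    insert (⋃₀ A, ⋃₀ B) D.specialEdges⟩

lemma MarkedDecomposition.isTreeLike_base (G : SimpleGraph V) :
    MarkedDecomposition.IsTreeLike G ⟨{G.toSplitComponent}, ∅⟩ where
  components_nonempty := ⟨_, rfl⟩
  isQuotient := by
    rintro K rfl
    exact isQuotient_toSplitComponent G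
  eq_compl X Y h := h.elim
  asymm X Y h := h.elim
  nontrivial X h := h.elim False.elim False.elim
  singleton_or_side := by
    rintro K rfl P ⟨v, rfl⟩
    exact Or.inl ⟨v, rfl⟩
  exists_component X h := h.elim False.elim False.elim
  subset_vertex X h := h.elim False.elim False.elim
  compl_notMem X h := h.elim False.elim False.elim
  covering_pair := by
    rintro K rfl L rfl h
    exact absurd rfl h
  side_or_union := by
    intro Z hZ hZc _
    refine Or.inr ⟨_, rfl, (fun v => {v}) '' Z, (fun v => {v}) '' Zᶜ, ?_, ?_, ?_, ?_, ?_⟩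
    · rw [← Set.image_union, Set.union_compl_self, Set.image_univ]
      rfl
    · exact (Set.disjoint_image_iff Set.singleton_injective).2 disjoint_compl_right
    · exact hZ.image Set.singleton_injective
    · exact hZc.image Set.singleton_injective
    · simp

namespace MarkedDecomposition.IsTreeLike

lemma sides_decompose (hD : IsTreeLike G D) (hK : K ∈ D.components) (h : K.IsProperSplit A B) :
    (D.decompose K A B).sides = {⋃₀ A, ⋃₀ B} ∪ D.sides := by
  have hc := (hD.isQuotient K hK).compl_sUnion h.1.1 h.1.2.1
  ext X
  simp only [sides, decompose, Set.mem_insert_iff, Prod.mk.injEq, Set.mem_ofPred_eq,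
    Set.mem_union, Set.mem_singleton_iff]
  constructor
  · rintro ((h | h) | (h | h))
    · exact Or.inl (Or.inl h.1)
    · exact Or.inr (Or.inl h)
    · exact Or.inl (Or.inr h.2)
    · exact Or.inr (Or.inr h)
  · rintro ((rfl | rfl) | (h | h))
    · exact Or.inl (Or.inl ⟨rfl, hc⟩)
    · exact Or.inr (Or.inl ⟨by rw [← hc, compl_compl], rfl⟩)
    · exact Or.inl (Or.inr h)
    · exact Or.inr (Or.inr h)

/-- No side splits a component properly. -/
lemma sUnion_notMem_sides (hD : IsTreeLike G D) (hK : K ∈ D.components)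
    (h : K.IsProperSplit A B) : ⋃₀ A ∉ D.sides := by
  have hQ := hD.isQuotient K hK
  have main : ∀ A B, A ∪ B = K.verts → Disjoint A B → A.Nontrivial → ∀ P ∈ K.verts, ¬ ⋃₀ A ⊆ P := by
    rintro A B hAB - ⟨Q, hQA, R, hRA, hne⟩ P hP hsub
    have e : ∀ Q ∈ A, Q = P := fun Q hQA => by
      obtain ⟨v, hv⟩ := hQ.nonempty Q (hAB ▸ Or.inl hQA)
      exact hQ.eq_of_mem Q (hAB ▸ Or.inl hQA) P hP v hv (hsub ⟨Q, hQA, hv⟩)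
    exact hne ((e Q hQA).trans (e R hRA).symm)
  obtain ⟨⟨hAB, hd, -⟩, hA, hB⟩ := h
  intro hmem
  obtain ⟨P, hP, h | h⟩ := hD.subset_vertex _ hmem K hK
  · exact main A B hAB hd hA P hP h
  · rw [hQ.compl_sUnion hAB hd] at h
    exact main B A (Set.union_comm A B ▸ hAB) hd.symm hB P hP h

end MarkedDecomposition.IsTreeLike

end TreeLike

/-! ### A decomposition step preserves the tree structure -/

section Decompose

variable {V : Type*} {G : SimpleGraph V} {D : MarkedDecomposition V} {K L : SplitComponent V}
  {A B A' B' : Set (Set V)}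

lemma SimpleGraph.Subgraph.IsProperSplit.symm (h : K.IsProperSplit A B) : K.IsProperSplit B A :=
  ⟨⟨Set.union_comm A B ▸ h.1.1, h.1.2.1.symm, fun a ha b hb => (h.1.2.2 b hb a ha).symm⟩,
    h.2.2, h.2.1⟩

lemma MarkedDecomposition.mem_components_decompose :
    L ∈ (D.decompose K A B).components ↔
      (L ∈ D.components ∧ L ≠ K) ∨ L = splitHalf K A B ∨ L = splitHalf K B A :=
  Iff.rfl

namespace IsQuotient

lemma sUnion_notMem_self (hK : IsQuotient G K) (hA : A ⊆ K.verts) (h : A.Nontrivial) :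
    ⋃₀ A ∉ A := by
  intro hmem
  obtain ⟨P, hP, Q, hQ, hPQ⟩ := h
  have e : ∀ R ∈ A, R = ⋃₀ A := fun R hR => by
    obtain ⟨v, hv⟩ := hK.nonempty R (hA hR)
    exact hK.eq_of_mem R (hA hR) _ (hA hmem) v hv ⟨R, hR, hv⟩
  exact hPQ ((e P hP).trans (e Q hQ).symm)

lemma exists_superset_splitHalf (hAB : A ∪ B = K.verts) {P : Set V} (hP : P ∈ K.verts) :
    ∃ P' ∈ (_root_.splitHalf K A B).verts, P ⊆ P' := by
  rw [← hAB] at hP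
  rcases hP with hP | hP
  · exact ⟨P, Or.inr hP, subset_rfl⟩
  · exact ⟨⋃₀ B, Or.inl rfl, Set.subset_sUnion_of_mem hP⟩

/-- A bipartition of `K` that refines the split `(A, B)` on the side of `A` induces a bipartition
of the corresponding half of `K`. -/
lemma exists_partition_splitHalf (hK : IsQuotient G K) (h : K.IsProperSplit A B)
    (hA' : A'.Nontrivial) (hsub : A' ⊆ A) (hne : A' ≠ A) :
    ∃ A₁ B₁, A₁ ∪ B₁ = (_root_.splitHalf K A B).verts ∧ Disjoint A₁ B₁ ∧
      A₁.Nontrivial ∧ B₁.Nontrivial ∧ ⋃₀ A₁ = ⋃₀ A' := by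
  have hB := hK.sUnion_notMem h.1.1 h.1.2.1 h.2.2.nonempty
  refine ⟨A', insert (⋃₀ B) (A \ A'), ?_, ?_, hA', ?_, rfl⟩
  · change _ = insert (⋃₀ B) A
    rw [Set.union_insert, Set.union_sdiff_cancel hsub]
  · rw [Set.disjoint_insert_right]
    exact ⟨fun h => hB (hsub h), Set.disjoint_sdiff_right⟩
  · obtain ⟨P, hP, hPA'⟩ := Set.exists_of_ssubset (hsub.ssubset_of_ne hne)
    exact ⟨_, Or.inl rfl, P, Or.inr ⟨hP, hPA'⟩, fun e => hB (e ▸ hP)⟩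

end IsQuotient

namespace MarkedDecomposition.IsTreeLike

/-- A component other than `K` has a vertex containing everything outside some vertex `P` of `K`. If
`P ∈ A`, that includes all of `⋃₀ B`, and symmetrically. -/
lemma exists_subset_vertex (hD : IsTreeLike G D) (hK : K ∈ D.components)
    (h : K.IsProperSplit A B) (hL : L ∈ (D.decompose K A B).components) :
    ∃ P ∈ L.verts, ⋃₀ A ⊆ P ∨ ⋃₀ B ⊆ P := by
  have hQ := hD.isQuotient K hK
  have hc := hQ.compl_sUnion h.1.1 h.1.2.1
  rcases mem_components_decompose.1 hL with ⟨hL, hne⟩ | rfl | rfl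
  · obtain ⟨P, hP, Q, hQL, hPQ⟩ := hD.covering_pair K hK L hL hne.symm
    have hsub : Pᶜ ⊆ Q := fun x hx => ((Set.ext_iff.1 hPQ x).2 trivial).resolve_left hx
    refine ⟨Q, hQL, ?_⟩
    rw [← h.1.1] at hP
    rcases hP with hP | hP
    · right
      rw [← hc]
      exact (Set.compl_subset_compl.2 (Set.subset_sUnion_of_mem hP)).trans hsub
    · left
      rw [← compl_compl (⋃₀ A), hc]
      exact (Set.compl_subset_compl.2 (Set.subset_sUnion_of_mem hP)).trans hsub
  · exact ⟨_, Or.inl rfl, Or.inr subset_rfl⟩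
  · exact ⟨_, Or.inl rfl, Or.inl subset_rfl⟩

lemma compl_notMem_splitHalf (hD : IsTreeLike G D) (hK : K ∈ D.components)
    (h : K.IsProperSplit A B) {X : Set V} (hX : X ∈ (D.decompose K A B).sides)
    (hXL : X ∈ (splitHalf K A B).verts) : Xᶜ ∉ (splitHalf K A B).verts := by
  have hQ := hD.isQuotient K hK
  have hc := hQ.compl_sUnion h.1.1 h.1.2.1
  have hc' : (⋃₀ B)ᶜ = ⋃₀ A := by rw [← hc, compl_compl]
  have hA := hD.sUnion_notMem_sides hK h
  have hB := hD.sUnion_notMem_sides hK h.symm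
  have hAA := hQ.sUnion_notMem_self (h.1.1 ▸ Set.subset_union_left) h.2.1
  have hne : ⋃₀ A ≠ ⋃₀ B := by
    rw [← hc]
    exact fun e => Set.nonempty_iff_ne_empty.1
      (hQ.sUnion_nontrivial (h.1.1 ▸ Set.subset_union_left) h.2.1).nonempty
      (by simpa using (le_compl_self.1 e.le))
  rw [hD.sides_decompose hK h] at hX
  rcases hX with (rfl | rfl) | hX
  · exact absurd hXL fun e => e.elim hne hAA
  · rw [hc']
    exact fun e => e.elim hne hAA
  · rintro (e | hXc)
    · exact hB (e ▸ compl_mem_sides hX)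
    · rcases hXL with rfl | hXA
      · exact hB hX
      · exact hD.compl_notMem X hX K hK (h.1.1 ▸ Or.inl hXA) (h.1.1 ▸ Or.inl hXc)

lemma decompose (hD : IsTreeLike G D) (hK : K ∈ D.components) (h : K.IsProperSplit A B) :
    IsTreeLike G (D.decompose K A B) := by
  have hQ := hD.isQuotient K hK
  have hAK : A ⊆ K.verts := h.1.1 ▸ Set.subset_union_left
  have hBK : B ⊆ K.verts := h.1.1 ▸ Set.subset_union_right
  have hc := hQ.compl_sUnion h.1.1 h.1.2.1
  have hc' : (⋃₀ B)ᶜ = ⋃₀ A := by rw [← hc, compl_compl]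
  have hA := hD.sUnion_notMem_sides hK h
  have hB := hD.sUnion_notMem_sides hK h.symm
  have hBA : B ∪ A = K.verts := h.symm.1.1
  have hsides := hD.sides_decompose hK h
  have hnewA : ⋃₀ A ∈ (D.decompose K A B).sides := hsides ▸ Or.inl (Or.inl rfl)
  have hnewB : ⋃₀ B ∈ (D.decompose K A B).sides := hsides ▸ Or.inl (Or.inr rfl)
  have hold : D.sides ⊆ (D.decompose K A B).sides := hsides ▸ Set.subset_union_right
  have hquot : ∀ L ∈ (D.decompose K A B).components, IsQuotient G L := by
    intro L hL
    rcases mem_components_decompose.1 hL with ⟨hL, -⟩ | rfl | rfl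
    · exact hD.isQuotient L hL
    · exact hQ.splitHalf h.1 h.2.2.nonempty
    · exact hQ.splitHalf h.symm.1 h.2.1.nonempty
  have hhalf1 : splitHalf K A B ∈ (D.decompose K A B).components :=
    mem_components_decompose.2 (Or.inr (Or.inl rfl))
  have hhalf2 : splitHalf K B A ∈ (D.decompose K A B).components :=
    mem_components_decompose.2 (Or.inr (Or.inr rfl))
  refine ⟨⟨_, hhalf1⟩, hquot, ?_, ?_, ?_, ?_, ?_, ?_, ?_, ?_, ?_⟩
  · rintro X Y (e | e)
    · simp only [Prod.mk.injEq] at e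
      rw [e.1, e.2, hc]
    · exact hD.eq_compl X Y e
  · have hnot : (⋃₀ B, ⋃₀ A) ∉ D.specialEdges := fun e => hA (Or.inr (hc.symm ▸ e))
    intro X Y e e'
    simp only [MarkedDecomposition.decompose, Set.mem_insert_iff, Prod.mk.injEq] at e e'
    rcases e with e | e <;> rcases e' with e' | e'
    · have : (⋃₀ A)ᶜ = ⋃₀ A := by rw [hc, ← e.2, e'.1]
      obtain ⟨v, hv⟩ := (hQ.sUnion_nontrivial hAK h.2.1).nonempty
      exact (this.symm ▸ hv : v ∈ (⋃₀ A)ᶜ) hv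
    · rw [e.1, e.2] at e'
      exact hnot e'
    · rw [e'.1, e'.2] at e
      exact hnot e
    · exact hD.asymm X Y e e'
  · rw [hsides]
    rintro X ((rfl | rfl) | hX)
    · exact hQ.sUnion_nontrivial hAK h.2.1
    · exact hQ.sUnion_nontrivial hBK h.2.2
    · exact hD.nontrivial X hX
  · intro L hL P hP
    rcases mem_components_decompose.1 hL with ⟨hL, -⟩ | rfl | rfl
    · exact (hD.singleton_or_side L hL P hP).imp_right fun h => hold h
    · rcases hP with rfl | hP
      · exact Or.inr hnewB
      · exact (hD.singleton_or_side K hK P (hAK hP)).imp_right fun h => hold h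
    · rcases hP with rfl | hP
      · exact Or.inr hnewA
      · exact (hD.singleton_or_side K hK P (hBK hP)).imp_right fun h => hold h
  · rw [hsides]
    rintro X ((rfl | rfl) | hX)
    · exact ⟨_, hhalf2, Or.inl rfl⟩
    · exact ⟨_, hhalf1, Or.inl rfl⟩
    · obtain ⟨L, hL, hXL⟩ := hD.exists_component X hX
      by_cases e : L = K
      · subst e
        rw [← h.1.1] at hXL
        rcases hXL with hXL | hXL
        · exact ⟨_, hhalf1, Or.inr hXL⟩
        · exact ⟨_, hhalf2, Or.inr hXL⟩
      · exact ⟨L, mem_components_decompose.2 (Or.inl ⟨hL, e⟩), hXL⟩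
  · rw [hsides]
    rintro X ((rfl | rfl) | hX) L hL
    · rw [hc]
      exact hD.exists_subset_vertex hK h hL
    · rw [hc']
      obtain ⟨P, hP, e⟩ := hD.exists_subset_vertex hK h hL
      exact ⟨P, hP, e.symm⟩
    · have key : ∀ A B, A ∪ B = K.verts →
          ∃ P ∈ (splitHalf K A B).verts, X ⊆ P ∨ Xᶜ ⊆ P := fun A B hAB => by
        obtain ⟨P, hP, e⟩ := hD.subset_vertex X hX K hK
        obtain ⟨P', hP', e'⟩ := IsQuotient.exists_superset_splitHalf hAB hP
        exact ⟨P', hP', e.imp (fun e => e.trans e') fun e => e.trans e'⟩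
      rcases mem_components_decompose.1 hL with ⟨hL, -⟩ | rfl | rfl
      · exact hD.subset_vertex X hX L hL
      · exact key A B h.1.1
      · exact key B A hBA
  · intro X hX L hL hXL hXcL
    rcases mem_components_decompose.1 hL with ⟨hL, -⟩ | rfl | rfl
    · rw [hsides] at hX
      have hnt : ∀ B : Set (Set V), (⋃₀ B).Nontrivial → ⋃₀ B ∉ D.sides → ⋃₀ B ∉ L.verts := by
        intro B hB hBs hBL
        rcases hD.singleton_or_side L hL _ hBL with ⟨v, e⟩ | e
        · rw [e] at hB
          exact Set.not_nontrivial_singleton hB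
        · exact hBs e
      rcases hX with (rfl | rfl) | hX
      · exact hnt A (hQ.sUnion_nontrivial hAK h.2.1) hA hXL
      · exact hnt B (hQ.sUnion_nontrivial hBK h.2.2) hB hXL
      · exact hD.compl_notMem X hX L hL hXL hXcL
    · exact hD.compl_notMem_splitHalf hK h hX hXL hXcL
    · refine hD.compl_notMem_splitHalf hK h.symm ?_ hXL hXcL
      rw [hsides] at hX
      rw [hD.sides_decompose hK h.symm, Set.pair_comm]
      exact hX
  · have key : ∀ L ∈ D.components, L ≠ K → ∀ A B, A ∪ B = K.verts →
        ∃ P ∈ (splitHalf K A B).verts, ∃ Q ∈ L.verts, P ∪ Q = Set.univ := by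
      intro L hL hne A B hAB
      obtain ⟨P, hP, Q, hQ, e⟩ := hD.covering_pair K hK L hL hne.symm
      obtain ⟨P', hP', e'⟩ := IsQuotient.exists_superset_splitHalf hAB hP
      exact ⟨P', hP', Q, hQ, Set.univ_subset_iff.1 (e ▸ Set.union_subset_union_left Q e')⟩
    have key' : ∀ L ∈ D.components, L ≠ K → ∀ A B, A ∪ B = K.verts →
        ∃ Q ∈ L.verts, ∃ P ∈ (splitHalf K A B).verts, Q ∪ P = Set.univ := by
      intro L hL hne A B hAB
      obtain ⟨P, hP, Q, hQ, e⟩ := key L hL hne A B hAB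
      exact ⟨Q, hQ, P, hP, Set.union_comm P Q ▸ e⟩
    have hun : ⋃₀ B ∪ ⋃₀ A = Set.univ := by rw [← hc, Set.compl_union_self]
    intro L hL M hM hne
    rcases mem_components_decompose.1 hL with ⟨hL, hLK⟩ | rfl | rfl <;>
      rcases mem_components_decompose.1 hM with ⟨hM, hMK⟩ | rfl | rfl
    · exact hD.covering_pair L hL M hM hne
    · exact key' L hL hLK A B h.1.1
    · exact key' L hL hLK B A hBA
    · exact key M hM hMK A B h.1.1
    · exact absurd rfl hne
    · exact ⟨_, Or.inl rfl, _, Or.inl rfl, hun⟩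
    · exact key M hM hMK B A hBA
    · exact ⟨_, Or.inl rfl, _, Or.inl rfl, Set.union_comm (⋃₀ B) _ ▸ hun⟩
    · exact absurd rfl hne
  · intro Z hZ hZc hcr
    rcases hD.side_or_union Z hZ hZc fun X hX => hcr X (hold hX) with
      hZs | ⟨L, hL, A', B', hAB', hd', hA', hB', rfl⟩
    · exact Or.inl (hold hZs)
    by_cases e : L = K
    swap
    · exact Or.inr ⟨L, mem_components_decompose.2 (Or.inl ⟨hL, e⟩), A', B', hAB', hd', hA', hB', rfl⟩
    subst e
    have one : ∀ A', A'.Nontrivial → A' ⊆ A ∨ A' ⊆ B → ⋃₀ A' ∈ (D.decompose L A B).sides ∨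
        ∃ M ∈ (D.decompose L A B).components, ∃ A₁ B₁, A₁ ∪ B₁ = M.verts ∧ Disjoint A₁ B₁ ∧
          A₁.Nontrivial ∧ B₁.Nontrivial ∧ ⋃₀ A₁ = ⋃₀ A' := by
      rintro A' hA' (hs | hs)
      · by_cases e : A' = A
        · exact Or.inl (e ▸ hnewA)
        · exact Or.inr ⟨_, hhalf1, hQ.exists_partition_splitHalf h hA' hs e⟩
      · by_cases e : A' = B
        · exact Or.inl (e ▸ hnewB)
        · exact Or.inr ⟨_, hhalf2, hQ.exists_partition_splitHalf h.symm hA' hs e⟩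
    -- A bipartition `(A', B')` of the component being split survives in one half as soon as `A'` or
    -- `B'` lies within `A` or `B`. Otherwise all four corners are nonempty, so `⋃₀ A'` crosses the
    -- new side, which is excluded.
    by_cases hs : A' ⊆ A ∨ A' ⊆ B
    · exact one A' hA' hs
    have hc₁ := hQ.compl_sUnion hAB' hd'
    by_cases hs' : B' ⊆ A ∨ B' ⊆ B
    · rcases one B' hB' hs' with h1 | ⟨M, hM, A₁, B₁, h1, h2, h3, h4, h5⟩
      · left
        rw [← compl_compl (⋃₀ A'), hc₁]
        exact compl_mem_sides h1
      · refine Or.inr ⟨M, hM, B₁, A₁, Set.union_comm A₁ B₁ ▸ h1, h2.symm, h4, h3, ?_⟩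
        rw [← (hquot M hM).compl_sUnion h1 h2, h5, ← hc₁, compl_compl]
    exfalso
    refine hcr _ hnewA ?_
    have corner : ∀ A B, A ∪ B = L.verts → ∀ A' ⊆ L.verts, ¬ A' ⊆ B → (⋃₀ A ∩ ⋃₀ A').Nonempty := by
      intro A B hAB A' hA' hnot
      obtain ⟨P, hP, hPB⟩ := Set.not_subset.1 hnot
      obtain ⟨v, hv⟩ := hQ.nonempty P (hA' hP)
      have hPA : P ∈ A ∪ B := hAB ▸ hA' hP
      exact ⟨v, ⟨P, hPA.resolve_right hPB, hv⟩, P, hP, hv⟩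
    rw [Crosses, hc, hc₁]
    simp only [not_or] at hs hs'
    have hA'L : A' ⊆ L.verts := hAB' ▸ Set.subset_union_left
    have hB'L : B' ⊆ L.verts := hAB' ▸ Set.subset_union_right
    exact ⟨corner A B h.1.1 A' hA'L hs.2, corner A B h.1.1 B' hB'L hs'.2,
      corner B A hBA A' hA'L hs.1, corner B A hBA B' hB'L hs'.1⟩

end MarkedDecomposition.IsTreeLike

lemma IsSplitDecomposition.isTreeLike (h : IsSplitDecomposition G D) :
    MarkedDecomposition.IsTreeLike G D := by
  induction h with
  | base => exact MarkedDecomposition.isTreeLike_base G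
  | step D _ K hK A B hAB ih => exact ih.decompose hK hAB

end Decompose

/-! ### The special edges of a skeleton are the strong splits -/

lemma crosses_compl_left {V : Type*} {X Z : Set V} : Crosses Xᶜ Z ↔ Crosses X Z :=
  ⟨fun h => by simpa only [compl_compl] using h.compl_left, fun h => h.compl_left⟩

lemma not_crosses_singleton {V : Type*} {Z : Set V} (v : V) : ¬ Crosses {v} Z := by
  rintro ⟨⟨a, rfl, ha⟩, ⟨b, rfl, hb⟩, -⟩
  exact hb ha

/-- `K` is complete, a star, or has no proper split. -/
def SimpleGraph.Subgraph.IsDegenerateOrPrime {α : Type*} {Γ : SimpleGraph α} (K : Γ.Subgraph) :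
    Prop :=
  K.IsCompleteComponent ∨ (∃ c, K.IsStarWithCenter c) ∨ ∀ A B, ¬ K.IsProperSplit A B

/-- The vertex set of `K` is partitioned into three nonempty sets, each of which is a side of a
split of `G`. -/
structure IsSplitTripartition {V : Type*} (G : SimpleGraph V) (K : SplitComponent V)
    (A B C : Set (Set V)) : Prop where
  isQuotient : IsQuotient G K
  union_eq : A ∪ (B ∪ C) = K.verts
  disjoint_left : Disjoint A B
  disjoint_outer : Disjoint A C
  disjoint_right : Disjoint B C
  nonempty_left : A.Nonempty
  nonempty_mid : B.Nonempty
  nonempty_right : C.Nonempty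
  isSplitSet_left : G.IsSplitSet (⋃₀ A)
  isSplitSet_mid : G.IsSplitSet (⋃₀ B)
  isSplitSet_right : G.IsSplitSet (⋃₀ C)

namespace IsSplitTripartition

variable {V : Type*} {G : SimpleGraph V} {K : SplitComponent V} {A B C : Set (Set V)}

/-- Cyclic symmetry, so that facts about one part or one pair suffice. -/
lemma rotate (h : IsSplitTripartition G K A B C) : IsSplitTripartition G K B C A where
  isQuotient := h.isQuotient
  union_eq := by rw [← h.union_eq, Set.union_comm A, Set.union_assoc]
  disjoint_left := h.disjoint_right
  disjoint_outer := h.disjoint_left.symm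
  disjoint_right := h.disjoint_outer.symm
  nonempty_left := h.nonempty_mid
  nonempty_mid := h.nonempty_right
  nonempty_right := h.nonempty_left
  isSplitSet_left := h.isSplitSet_mid
  isSplitSet_mid := h.isSplitSet_right
  isSplitSet_right := h.isSplitSet_left

lemma subset (h : IsSplitTripartition G K A B C) : A ⊆ K.verts :=
  h.union_eq ▸ Set.subset_union_left

/-- Two elements in `A` would make `(A, B ∪ C)` a proper split. So a component without proper splits
has just three vertices here. -/
lemma subsingleton (h : IsSplitTripartition G K A B C)
    (hK : ∀ A B, ¬ K.IsProperSplit A B) : A.Subsingleton := by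
  rw [← Set.not_nontrivial_iff]
  intro hA
  have hd : Disjoint A (B ∪ C) := Set.disjoint_union_right.2 ⟨h.disjoint_left, h.disjoint_outer⟩
  obtain ⟨b, hb⟩ := h.nonempty_mid
  obtain ⟨c, hc⟩ := h.nonempty_right
  exact hK A (B ∪ C) ⟨h.isQuotient.isSplit_of_isSplitSet h.union_eq hd h.isSplitSet_left, hA,
    b, Or.inl hb, c, Or.inr hc, fun e => Set.disjoint_left.1 h.disjoint_right hb (e ▸ hc)⟩

lemma touches_iff (h : IsSplitTripartition G K A B C) :
    G.Touches (⋃₀ A) (⋃₀ B) ↔ ∃ P ∈ A, ∃ Q ∈ B, K.Adj P Q := by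
  constructor
  · rintro ⟨u, ⟨P, hP, hu⟩, v, ⟨Q, hQ, hv⟩, huv⟩
    exact ⟨P, hP, Q, hQ, (h.isQuotient.adj_iff P Q).2 ⟨h.subset hP, h.rotate.subset hQ,
      fun e => Set.disjoint_left.1 h.disjoint_left hP (e ▸ hQ), u, hu, v, hv, huv⟩⟩
  · rintro ⟨P, hP, Q, hQ, hPQ⟩
    obtain ⟨-, -, -, u, hu, v, hv, huv⟩ := (h.isQuotient.adj_iff P Q).1 hPQ
    exact ⟨u, ⟨P, hP, hu⟩, v, ⟨Q, hQ, hv⟩, huv⟩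

lemma center_mem (h : IsSplitTripartition G K A B C) {c : Set V} (hc : K.IsStarWithCenter c)
    (ht : G.Touches (⋃₀ A) (⋃₀ B)) : c ∈ A ∪ B := by
  obtain ⟨P, hP, Q, hQ, hPQ⟩ := h.touches_iff.1 ht
  rcases ((hc.2 P (h.subset hP) Q (h.rotate.subset hQ)).1 hPQ).2 with rfl | rfl
  · exact Or.inl hP
  · exact Or.inr hQ

/-- A star is impossible, since its centre would have to meet each of three pairs of disjoint parts;
a component without proper splits is a triangle. -/
lemma isCompleteComponent (h : IsSplitTripartition G K A B C) (hK : K.IsDegenerateOrPrime)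
    (h1 : G.Touches (⋃₀ A) (⋃₀ B)) (h2 : G.Touches (⋃₀ B) (⋃₀ C))
    (h3 : G.Touches (⋃₀ C) (⋃₀ A)) : K.IsCompleteComponent := by
  rcases hK with hK | ⟨c, hc⟩ | hK
  · exact hK
  · exfalso
    have e1 : c ∈ A → c ∉ B := fun e => Set.disjoint_left.1 h.disjoint_left e
    have e2 : c ∈ B → c ∉ C := fun e => Set.disjoint_left.1 h.disjoint_right e
    have e3 : c ∈ A → c ∉ C := fun e => Set.disjoint_left.1 h.disjoint_outer e
    have f1 := h.center_mem hc h1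
    have f2 := h.rotate.center_mem hc h2
    have f3 := h.rotate.rotate.center_mem hc h3
    simp only [Set.mem_union] at f1 f2 f3
    tauto
  · obtain ⟨P, hP, Q, hQ, hPQ⟩ := h.touches_iff.1 h1
    obtain ⟨Q', hQ', R, hR, hQR⟩ := h.rotate.touches_iff.1 h2
    obtain ⟨R', hR', P', hP', hRP⟩ := h.rotate.rotate.touches_iff.1 h3
    obtain rfl := h.subsingleton hK hP hP'
    obtain rfl := h.rotate.subsingleton hK hQ hQ'
    obtain rfl := h.rotate.rotate.subsingleton hK hR hR'
    have key : ∀ x ∈ K.verts, x = P ∨ x = Q ∨ x = R := by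
      rw [← h.union_eq]
      rintro x (hx | hx | hx)
      · exact Or.inl (h.subsingleton hK hx hP)
      · exact Or.inr (Or.inl (h.rotate.subsingleton hK hx hQ))
      · exact Or.inr (Or.inr (h.rotate.rotate.subsingleton hK hx hR))
    intro x hx y hy hxy
    rcases key x hx with rfl | rfl | rfl <;> rcases key y hy with rfl | rfl | rfl
    · exact absurd rfl hxy
    · exact hPQ
    · exact hRP.symm
    · exact hPQ.symm
    · exact absurd rfl hxy
    · exact hQR
    · exact hRP
    · exact hQR.symm
    · exact absurd rfl hxy

lemma exists_isStarWithCenter (h : IsSplitTripartition G K A B C) (hK : K.IsDegenerateOrPrime)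
    (h1 : G.Touches (⋃₀ A) (⋃₀ B)) (h2 : ¬ G.Touches (⋃₀ B) (⋃₀ C))
    (h3 : G.Touches (⋃₀ C) (⋃₀ A)) : ∃ c ∈ A, K.IsStarWithCenter c := by
  rcases hK with hK | ⟨c, hc⟩ | hK
  · exfalso
    obtain ⟨Q, hQ⟩ := h.nonempty_mid
    obtain ⟨R, hR⟩ := h.nonempty_right
    exact h2 (h.rotate.touches_iff.2 ⟨Q, hQ, R, hR, hK Q (h.rotate.subset hQ) R
      (h.rotate.rotate.subset hR) fun e => Set.disjoint_left.1 h.disjoint_right hQ (e ▸ hR)⟩)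
  · refine ⟨c, ?_, hc⟩
    have e2 : c ∈ B → c ∉ C := fun e => Set.disjoint_left.1 h.disjoint_right e
    have f1 := h.center_mem hc h1
    have f3 := h.rotate.rotate.center_mem hc h3
    simp only [Set.mem_union] at f1 f3
    tauto
  · obtain ⟨P, hP, Q, hQ, hPQ⟩ := h.touches_iff.1 h1
    obtain ⟨R, hR, P', hP', hRP⟩ := h.rotate.rotate.touches_iff.1 h3
    obtain rfl := h.subsingleton hK hP hP'
    have hQR : ¬ K.Adj Q R := fun e => h2 (h.rotate.touches_iff.2 ⟨Q, hQ, R, hR, e⟩)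
    have key : ∀ x ∈ K.verts, x = P ∨ x = Q ∨ x = R := by
      rw [← h.union_eq]
      rintro x (hx | hx | hx)
      · exact Or.inl (h.subsingleton hK hx hP)
      · exact Or.inr (Or.inl (h.rotate.subsingleton hK hx hQ))
      · exact Or.inr (Or.inr (h.rotate.rotate.subsingleton hK hx hR))
    refine ⟨P, hP, h.subset hP, fun x hx y hy => ?_⟩
    have n1 := hPQ.ne
    have n2 := hRP.ne
    rcases key x hx with rfl | rfl | rfl <;> rcases key y hy with rfl | rfl | rfl
    · exact iff_of_false (fun e => e.ne rfl) fun e => e.1 rfl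
    · exact iff_of_true hPQ ⟨n1, Or.inl rfl⟩
    · exact iff_of_true hRP.symm ⟨n2.symm, Or.inl rfl⟩
    · exact iff_of_true hPQ.symm ⟨n1.symm, Or.inr rfl⟩
    · exact iff_of_false (fun e => e.ne rfl) fun e => e.1 rfl
    · exact iff_of_false hQR fun e => e.2.elim n1.symm n2
    · exact iff_of_true hRP ⟨n2, Or.inr rfl⟩
    · exact iff_of_false (fun e => hQR e.symm) fun e => e.2.elim n2 n1.symm
    · exact iff_of_false (fun e => e.ne rfl) fun e => e.1 rfl

end IsSplitTripartition

section Skeleton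

variable {V : Type*} {G : SimpleGraph V} {D : MarkedDecomposition V} {K L : SplitComponent V}
  {X Y Z P : Set V}

lemma SimpleGraph.touches_union_left {S T U : Set V} :
    G.Touches (S ∪ T) U ↔ G.Touches S U ∨ G.Touches T U := by
  constructor
  · rintro ⟨u, hu | hu, v, hv, h⟩
    · exact Or.inl ⟨u, hu, v, hv, h⟩
    · exact Or.inr ⟨u, hu, v, hv, h⟩
  · rintro (⟨u, hu, v, hv, h⟩ | ⟨u, hu, v, hv, h⟩)
    · exact ⟨u, Or.inl hu, v, hv, h⟩
    · exact ⟨u, Or.inr hu, v, hv, h⟩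

lemma SimpleGraph.touches_union_right {S T U : Set V} :
    G.Touches U (S ∪ T) ↔ G.Touches U S ∨ G.Touches U T := by
  rw [touches_comm, touches_union_left, touches_comm, touches_comm (S := T)]

/-- If `Z` crosses the vertex `Y` of the component `K` but no other vertex of `K`, then it
partitions the remaining vertices of `K` into two parts. -/
lemma IsQuotient.exists_isSplitTripartition (hK : IsQuotient G K) (hG : G.CutConnected)
    (hY : Y ∈ K.verts) (hZ : G.IsSplitSet Z) (hc : Crosses Y Z)
    (hP : ∀ P ∈ K.verts, P ≠ Y → ¬ Crosses P Z) :
    ∃ A B, IsSplitTripartition G K {Y} A B ∧ ⋃₀ A = Yᶜ ∩ Z ∧ ⋃₀ B = Yᶜ ∩ Zᶜ := by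
  have hYs := hK.isSplitSet Y hY
  have mono : ∀ P ∈ K.verts, P = Y ∨ P ⊆ Yᶜ ∩ Z ∨ P ⊆ Yᶜ ∩ Zᶜ := by
    intro P hPK
    by_cases e : P = Y
    · exact Or.inl e
    right
    have hsub : P ⊆ Yᶜ := fun v hv hvY => e (hK.eq_of_mem P hPK Y hY v hv hvY)
    by_contra hno
    simp only [not_or, Set.not_subset] at hno
    obtain ⟨⟨v, hv, hv'⟩, w, hw, hw'⟩ := hno
    refine hP P hPK e ⟨⟨w, hw, ?_⟩, ⟨v, hv, fun h => hv' ⟨hsub hv, h⟩⟩, ?_, ?_⟩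
    · by_contra h
      exact hw' ⟨hsub hw, h⟩
    · exact hc.1.mono (Set.inter_subset_inter_left _ fun v hv hvP => hsub hvP hv)
    · exact hc.2.1.mono (Set.inter_subset_inter_left _ fun v hv hvP => hsub hvP hv)
  have cover : ∀ W : Set V, (∀ v ∈ W, ∀ P ∈ K.verts, v ∈ P → P ⊆ W) →
      ⋃₀ {P | P ∈ K.verts ∧ P ⊆ W} = W := by
    intro W hW
    refine subset_antisymm (Set.sUnion_subset fun P hP => hP.2) fun v hv => ?_
    obtain ⟨P, hP, hvP⟩ := hK.cover v
    exact ⟨P, ⟨hP, hW v hv P hP hvP⟩, hvP⟩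
  have c1 : ⋃₀ {P | P ∈ K.verts ∧ P ⊆ Yᶜ ∩ Z} = Yᶜ ∩ Z := cover _ fun v hv P hP hvP => by
    rcases mono P hP with rfl | h | h
    · exact absurd hvP hv.1
    · exact h
    · exact absurd hv.2 (h hvP).2
  have c2 : ⋃₀ {P | P ∈ K.verts ∧ P ⊆ Yᶜ ∩ Zᶜ} = Yᶜ ∩ Zᶜ := cover _ fun v hv P hP hvP => by
    rcases mono P hP with rfl | h | h
    · exact absurd hvP hv.1
    · exact absurd (h hvP).2 hv.2
    · exact h
  have hne : ∀ S : Set (Set V), (⋃₀ S).Nonempty → S.Nonempty := fun S ⟨_, P, hP, _⟩ => ⟨P, hP⟩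
  refine ⟨_, _, ⟨hK, ?_, ?_, ?_, ?_, Set.singleton_nonempty Y, ?_, ?_, by simpa using hYs, ?_, ?_⟩,
    c1, c2⟩
  · ext P
    constructor
    · rintro (rfl | h | h)
      · exact hY
      · exact h.1
      · exact h.1
    · intro h
      exact (mono P h).imp id (Or.imp (fun e => ⟨h, e⟩) fun e => ⟨h, e⟩)
  · rw [Set.disjoint_singleton_left]
    rintro ⟨-, h⟩
    obtain ⟨v, hv⟩ := hK.nonempty Y hY
    exact (h hv).1 hv
  · rw [Set.disjoint_singleton_left]
    rintro ⟨-, h⟩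
    obtain ⟨v, hv⟩ := hK.nonempty Y hY
    exact (h hv).1 hv
  · rw [Set.disjoint_left]
    rintro P ⟨hP, h⟩ ⟨-, h'⟩
    obtain ⟨v, hv⟩ := hK.nonempty P hP
    exact (h' hv).2 (h hv).2
  · exact hne _ (by rw [c1]; exact hc.2.2.1)
  · exact hne _ (by rw [c2]; exact hc.2.2.2)
  · rw [c1]
    exact hYs.compl.inter hG hZ hc.compl_left
  · rw [c2]
    exact hYs.compl.inter hG hZ.compl hc.compl_left.compl_right

/-- The shape of a component `K` with a vertex `Y` is determined by the corners of any split that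
crosses `Y` and no other vertex of `K`. -/
lemma IsQuotient.shape (hK : IsQuotient G K) (hKd : K.IsDegenerateOrPrime) (hG : G.CutConnected)
    (hY : Y ∈ K.verts) (hZ : G.IsSplitSet Z) (hc : Crosses Y Z)
    (hP : ∀ P ∈ K.verts, P ≠ Y → ¬ Crosses P Z) {a b c d : Set V} (ha : a = Yᶜ ∩ Z)
    (hb : b = Yᶜ ∩ Zᶜ) (hc' : c = Y ∩ Z) (hd : d = Y ∩ Zᶜ) :
    (G.Touches a b → G.Touches a c ∨ G.Touches a d → G.Touches b c ∨ G.Touches b d →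
      K.IsCompleteComponent) ∧
    (¬ G.Touches a b → G.Touches a c ∨ G.Touches a d → G.Touches b c ∨ G.Touches b d →
      K.IsStarWithCenter Y) ∧
    (G.Touches a b → G.Touches a c ∨ G.Touches a d → ¬ (G.Touches b c ∨ G.Touches b d) →
      ∃ e, e ≠ Y ∧ K.IsStarWithCenter e) ∧
    (G.Touches a b → ¬ (G.Touches a c ∨ G.Touches a d) → G.Touches b c ∨ G.Touches b d →
      ∃ e, e ≠ Y ∧ K.IsStarWithCenter e) := by
  obtain ⟨A, B, h, hA, hB⟩ := hK.exists_isSplitTripartition hG hY hZ hc hP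
  have hYe : c ∪ d = ⋃₀ {Y} := by
    rw [hc', hd, ← Set.inter_union_distrib_left, Set.union_compl_self, Set.inter_univ,
      Set.sUnion_singleton]
  rw [← SimpleGraph.touches_union_right, ← SimpleGraph.touches_union_right, hYe, ha, hb,
    ← hA, ← hB]
  refine ⟨fun h1 h2 h3 => ?_, fun h1 h2 h3 => ?_, fun h1 h2 h3 => ?_, fun h1 h2 h3 => ?_⟩
  · exact h.isCompleteComponent hKd h2.symm h1 h3
  · obtain ⟨e, rfl, he⟩ := h.exists_isStarWithCenter hKd h2.symm h1 h3
    exact he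
  · obtain ⟨e, he, hs⟩ := h.rotate.exists_isStarWithCenter hKd h1 h3 h2.symm
    exact ⟨e, fun e' => Set.disjoint_left.1 h.disjoint_left e' he, hs⟩
  · obtain ⟨e, he, hs⟩ := h.rotate.rotate.exists_isStarWithCenter hKd h3
      (fun e => h2 e.symm) h1
    exact ⟨e, fun e' => Set.disjoint_left.1 h.disjoint_outer e' he, hs⟩

/-- Every bipartition of a complete graph or of a star is a split. -/
lemma isSplit_of_complete_or_star {A B : Set (Set V)}
    (hK : K.IsCompleteComponent ∨ ∃ c, K.IsStarWithCenter c) (hAB : A ∪ B = K.verts)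
    (hd : Disjoint A B) : K.IsSplit A B := by
  refine ⟨hAB, hd, ?_⟩
  have hne : ∀ P ∈ A, ∀ Q ∈ B, P ≠ Q := fun P hP Q hQ e => Set.disjoint_left.1 hd hP (e ▸ hQ)
  have hA : A ⊆ K.verts := hAB ▸ Set.subset_union_left
  have hB : B ⊆ K.verts := hAB ▸ Set.subset_union_right
  rcases hK with hc | ⟨c, hc⟩
  · rintro P ⟨hP, -⟩ Q ⟨hQ, -⟩
    exact hc P (hA hP) Q (hB hQ) (hne P hP Q hQ)
  · rintro P ⟨hP, Q, hQ, hPQ⟩ Q' ⟨hQ', P', hP', hPQ'⟩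
    refine (hc.2 P (hA hP) Q' (hB hQ')).2 ⟨hne P hP Q' hQ', ?_⟩
    rcases ((hc.2 P (hA hP) Q (hB hQ)).1 hPQ).2 with e | rfl
    · exact Or.inl e
    · rcases ((hc.2 Q' (hB hQ') P' (hA hP')).1 hPQ').2 with e | rfl
      · exact Or.inr e
      · exact absurd rfl (hne _ hP' _ hQ)

namespace MarkedDecomposition.IsTreeLike

lemma isSplitSet (hD : IsTreeLike G D) (hX : X ∈ D.sides) : G.IsSplitSet X := by
  obtain ⟨K, hK, hXK⟩ := hD.exists_component X hX
  exact (hD.isQuotient K hK).isSplitSet X hXK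

/-- `X` is a vertex of some component, and `P` or its complement lies inside one vertex `Q` of it. A
crossing would make `Q` meet `X`, hence equal it, leaving a corner empty. -/
lemma not_crosses (hD : IsTreeLike G D) (hX : X ∈ D.sides) (hP : P ∈ D.sides) :
    ¬ Crosses X P := by
  obtain ⟨K, hK, hXK⟩ := hD.exists_component X hX
  have hQ := hD.isQuotient K hK
  have key : ∀ P, ¬ Crosses X P ∨ ∀ Q ∈ K.verts, ¬ P ⊆ Q := by
    intro P
    by_contra hno
    push Not at hno
    obtain ⟨⟨⟨v, hv, hvP⟩, -, ⟨w, hw, hwP⟩, -⟩, Q, hQK, hPQ⟩ := hno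
    exact hw (hQ.eq_of_mem Q hQK X hXK v (hPQ hvP) hv ▸ hPQ hwP)
  obtain ⟨Q, hQK, h | h⟩ := hD.subset_vertex P hP K hK
  · exact (key P).resolve_right fun e => e Q hQK h
  · exact fun e => (key Pᶜ).resolve_right (fun e => e Q hQK h) e.compl_right

end MarkedDecomposition.IsTreeLike

/-! ### Uncrossing: special edges are strong splits, and conversely -/

namespace IsSkeleton

lemma isTreeLike (h : IsSkeleton G D) : MarkedDecomposition.IsTreeLike G D :=
  h.isSplitDecomposition.isTreeLike

/-- A split that crosses a special edge of a skeleton also crosses another one. -/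
lemma exists_crosses (h : IsSkeleton G D) (hG : G.CutConnected) (hX : (X, Xᶜ) ∈ D.specialEdges)
    (hZ : G.IsSplitSet Z) (hc : Crosses X Z) :
    ∃ P ∈ D.sides, P ≠ X ∧ P ≠ Xᶜ ∧ Crosses P Z := by
  by_contra hno
  push Not at hno
  have hD := h.isTreeLike
  have hXs : X ∈ D.sides := Or.inl hX
  have hXcs := MarkedDecomposition.compl_mem_sides hXs
  obtain ⟨K, hK, hYK⟩ := hD.exists_component Xᶜ hXcs
  obtain ⟨L, hL, hXL⟩ := hD.exists_component X hXs
  -- Singletons are never crossed, and `Xᶜ` is no vertex of a component that has `X` as one.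
  have other : ∀ X ∈ D.sides, (∀ P ∈ D.sides, P ≠ X → P ≠ Xᶜ → ¬ Crosses P Z) →
      ∀ K ∈ D.components, X ∈ K.verts → ∀ P ∈ K.verts, P ≠ X → ¬ Crosses P Z := by
    intro X hX hno K hK hXK P hP hne
    rcases hD.singleton_or_side K hK P hP with ⟨v, rfl⟩ | hPs
    · exact not_crosses_singleton v
    · exact hno P hPs hne fun e => hD.compl_notMem X hX K hK hXK (e ▸ hP)
  have hK' := (hD.isQuotient K hK).shape (h.component K hK) hG hYK hZ hc.compl_left
    (other _ hXcs (fun P hP h1 h2 => hno P hP (by simpa using h2) h1) K hK hYK)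
    (a := X ∩ Z) (b := X ∩ Zᶜ) (by rw [compl_compl]) (by rw [compl_compl]) rfl rfl
  have hL' := (hD.isQuotient L hL).shape (h.component L hL) hG hXL hZ hc
    (other _ hXs hno L hL hXL) rfl rfl rfl rfl
  have hcc := h.not_complete_complete X Xᶜ hX K hK hYK L hL hXL
  have hcl := h.not_center_leaf X Xᶜ hX K hK hYK L hL hXL
  obtain ⟨k1, k2, k3, k4⟩ := hK'
  obtain ⟨l1, l2, l3, l4⟩ := hL'
  have hcorn := SimpleGraph.IsSplitSet.corners hG (hD.isSplitSet hXs) hZ hc rfl rfl rfl rfl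
  rw [SimpleGraph.touches_comm (S := Xᶜ ∩ Z) (T := X ∩ Z),
    SimpleGraph.touches_comm (S := Xᶜ ∩ Z) (T := X ∩ Zᶜ),
    SimpleGraph.touches_comm (S := Xᶜ ∩ Zᶜ) (T := X ∩ Z),
    SimpleGraph.touches_comm (S := Xᶜ ∩ Zᶜ) (T := X ∩ Zᶜ)] at l1 l2 l3 l4
  -- Complete corners make `K` and `L` both complete. A star centred at a corner inside `X` makes
  -- the marker `X` the centre of `L` and the marker `Xᶜ` a leaf of `K`; for a centre inside `Xᶜ`
  -- the roles are reversed.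
  rcases hcorn with ⟨h1, h2, h3, h4, h5, h6⟩ | ⟨h1, h2, h3, h4, h5, h6⟩ |
      ⟨h1, h2, h3, h4, h5, h6⟩ | ⟨h1, h2, h3, h4, h5, h6⟩ | ⟨h1, h2, h3, h4, h5, h6⟩
  · exact hcc ⟨k1 h1 (Or.inl h2) (Or.inl h4), l1 h6 (Or.inl h2) (Or.inl h3)⟩
  · obtain ⟨e, he, hs⟩ := k3 h1 (Or.inl h2) (fun e => e.elim h4 h5)
    exact he ((hcl e X hs (l2 h6 (Or.inl h2) (Or.inl h3))).2 rfl)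
  · obtain ⟨e, he, hs⟩ := k4 h1 (fun e => e.elim h2 h3) (Or.inl h4)
    exact he ((hcl e X hs (l2 h6 (Or.inr h4) (Or.inr h5))).2 rfl)
  · obtain ⟨e, he, hs⟩ := l3 h6 (Or.inl h2) (fun e => e.elim h3 h5)
    exact he ((hcl Xᶜ e (k2 h1 (Or.inl h2) (Or.inl h4)) hs).1 rfl)
  · obtain ⟨e, he, hs⟩ := l4 h6 (fun e => e.elim h2 h4) (Or.inl h3)
    exact he ((hcl Xᶜ e (k2 h1 (Or.inr h3) (Or.inr h5)) hs).1 rfl)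

/-- Induction on the number of sides crossed by `Z`. Another crossed side `P` is nested with `X` up
to complements, so `Z` can be uncrossed from it while still crossing `X`. Sides never cross each
other, so no new crossing appears and the count drops. -/
lemma not_crosses_of_isSplitSet [Finite V] (h : IsSkeleton G D) (hG : G.CutConnected)
    (hX : (X, Xᶜ) ∈ D.specialEdges) (hZ : G.IsSplitSet Z) : ¬ Crosses X Z := by
  have hD := h.isTreeLike
  have hXs : X ∈ D.sides := Or.inl hX
  induction hn : {S | S ∈ D.sides ∧ Crosses S Z}.ncard using Nat.strong_induction_on
    generalizing Z with
  | _ n ih =>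
  subst hn
  intro hc
  obtain ⟨P, hP, hne, hne', hPZ⟩ := h.exists_crosses hG hX hZ hc
  have step : ∀ X' P', X' = X ∨ X' = Xᶜ → P' = P ∨ P' = Pᶜ → P' ⊆ X' → False := by
    intro X' P' hX' hP' hsub
    have hXc : ∀ Z, Crosses X' Z ↔ Crosses X Z := by
      intro Z
      rcases hX' with rfl | rfl
      · rfl
      · exact crosses_compl_left
    have hPc : ∀ Z, Crosses P' Z ↔ Crosses P Z := by
      intro Z
      rcases hP' with rfl | rfl
      · rfl
      · exact crosses_compl_left
    have hP's : P' ∈ D.sides := by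
      rcases hP' with rfl | rfl
      · exact hP
      · exact MarkedDecomposition.compl_mem_sides hP
    have hne'' : P' ≠ X' := by
      rcases hX' with rfl | rfl <;> rcases hP' with rfl | rfl
      · exact hne
      · exact fun e => hne' (by rw [← e, compl_compl])
      · exact hne'
      · exact fun e => hne (compl_injective e)
    obtain ⟨Z', h1, h2, h3, h4⟩ := hZ.exists_uncross hG (hD.isSplitSet hP's) ((hXc Z).2 hc)
      ((hPc Z).2 hPZ) hsub hne''
    refine ih _ (Set.ncard_lt_ncard ⟨?_, fun hle => ?_⟩ (Set.toFinite _)) h1 rfl ((hXc Z').1 h2)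
    · rintro S ⟨hS, hSZ⟩
      refine ⟨hS, ?_⟩
      by_contra hno
      exact h4 S hno (hD.not_crosses hS hP's) hSZ
    · exact h3 ((hPc Z').2 (hle ⟨hP, hPZ⟩).2)
  have hlam := hD.not_crosses hP hXs
  have corner : ∀ X' P' : Set V, P' ⊆ X'ᶜ ∨ (P' ∩ X').Nonempty := by
    intro X' P'
    by_contra hno
    simp only [not_or, Set.not_subset, Set.not_nonempty_iff_eq_empty] at hno
    obtain ⟨⟨v, hv, hv'⟩, e⟩ := hno
    exact (e ▸ (⟨hv, not_not.1 hv'⟩ : v ∈ P' ∩ X') : v ∈ (∅ : Set V))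
  refine hlam ⟨(corner X P).resolve_left ?_, (corner Xᶜ P).resolve_left ?_,
    (corner X Pᶜ).resolve_left ?_, (corner Xᶜ Pᶜ).resolve_left ?_⟩
  · exact step _ _ (Or.inr rfl) (Or.inl rfl)
  · exact step _ _ (Or.inl (compl_compl X)) (Or.inl rfl)
  · exact step _ _ (Or.inr rfl) (Or.inr rfl)
  · exact step _ _ (Or.inl (compl_compl X)) (Or.inr rfl)

lemma mem_sides_of_isStrongSplit (h : IsSkeleton G D) (hX : G.IsStrongSplit X) : X ∈ D.sides := by
  have hD := h.isTreeLike
  rcases hD.side_or_union X hX.nontrivial hX.compl_nontrivial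
    (fun S hS hc => hX.not_crosses S (hD.isSplitSet hS) hc.symm) with
    hs | ⟨K, hK, A, B, hAB, hd, hA, hB, rfl⟩
  · exact hs
  exfalso
  have hQ := hD.isQuotient K hK
  have hAK : A ⊆ K.verts := hAB ▸ Set.subset_union_left
  have hBK : B ⊆ K.verts := hAB ▸ Set.subset_union_right
  have hKd : K.IsCompleteComponent ∨ ∃ c, K.IsStarWithCenter c := by
    rcases h.component K hK with hc | hc | hc
    · exact Or.inl hc
    · exact Or.inr hc
    · exact absurd ⟨hQ.isSplit_of_isSplitSet hAB hd hX.isSplitSet, hA, hB⟩ (hc A B)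
  -- In a complete graph or star every bipartition is a split, so `{P, Q}` with one element from
  -- each side of `(A, B)` gives a split crossing `⋃₀ A`.
  obtain ⟨P, hP, P', hP', hPP'⟩ := hA
  obtain ⟨Q, hQB, Q', hQ'B, hQQ'⟩ := hB
  have hne : ∀ P ∈ A, ∀ Q ∈ B, P ≠ Q := fun P hP Q hQ e => Set.disjoint_left.1 hd hP (e ▸ hQ)
  have hsub : {P, Q} ⊆ K.verts := Set.pair_subset (hAK hP) (hBK hQB)
  have hZ : G.IsSplitSet (⋃₀ {P, Q}) := hQ.isSplitSet_sUnion
    (isSplit_of_complete_or_star hKd (Set.union_sdiff_cancel hsub) Set.disjoint_sdiff_right)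
  have hin : ∀ R ∈ ({P, Q} : Set (Set V)), R ⊆ ⋃₀ {P, Q} := fun R => Set.subset_sUnion_of_mem
  have hout : ∀ R ∈ K.verts, R ≠ P → R ≠ Q → R ⊆ (⋃₀ {P, Q})ᶜ := fun R hR h1 h2 v hv hvZ =>
    (hQ.mem_of_mem_sUnion hsub hR hv hvZ).elim h1 h2
  refine hX.not_crosses _ hZ ?_
  rw [Crosses, hQ.compl_sUnion hAB hd]
  obtain ⟨p, hp⟩ := hQ.nonempty P (hAK hP)
  obtain ⟨p', hp'⟩ := hQ.nonempty P' (hAK hP')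
  obtain ⟨q, hq⟩ := hQ.nonempty Q (hBK hQB)
  obtain ⟨q', hq'⟩ := hQ.nonempty Q' (hBK hQ'B)
  exact ⟨⟨p, ⟨P, hP, hp⟩, hin P (Or.inl rfl) hp⟩,
    ⟨p', ⟨P', hP', hp'⟩, hout P' (hAK hP') hPP'.symm (hne P' hP' Q hQB) hp'⟩,
    ⟨q, ⟨Q, hQB, hq⟩, hin Q (Or.inr rfl) hq⟩,
    ⟨q', ⟨Q', hQ'B, hq'⟩, hout Q' (hBK hQ'B) (hne P hP Q' hQ'B).symm hQQ'.symm hq'⟩⟩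

/-- The special edges of a skeleton of a prime graph are exactly its strong splits. -/
theorem mem_sides_iff [Finite V] (h : IsSkeleton G D) (hG : G.IsPrimeGraph) :
    X ∈ D.sides ↔ G.IsStrongSplit X := by
  refine ⟨fun hX => ?_, h.mem_sides_of_isStrongSplit⟩
  have hD := h.isTreeLike
  have h1 := hD.nontrivial X hX
  have h2 := hD.nontrivial _ (MarkedDecomposition.compl_mem_sides hX)
  refine ⟨hD.isSplitSet hX, h1, h2, fun Z hZ hc => ?_⟩
  have hconn := hG.cutConnected h1 h2
  rcases hX with hX | hX
  · exact h.not_crosses_of_isSplitSet hconn hX hZ hc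
  · exact h.not_crosses_of_isSplitSet (X := Xᶜ) hconn (by rwa [compl_compl]) hZ hc.compl_left

end IsSkeleton

end Skeleton

/-! ### An intrinsic description of the components of a skeleton -/

/-- A partition of the vertex set into singletons and sides of strong splits that is not split by
any strong split, i.e. the vertex set of a component of a skeleton. -/
structure SimpleGraph.IsNode {V : Type*} (G : SimpleGraph V) (N : Set (Set V)) : Prop where
  nonempty : ∀ P ∈ N, P.Nonempty
  cover : ∀ v, ∃ P ∈ N, v ∈ P
  eq_of_mem : ∀ P ∈ N, ∀ Q ∈ N, ∀ v ∈ P, v ∈ Q → P = Q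
  singleton_or_strong : ∀ P ∈ N, (∃ v, P = {v}) ∨ G.IsStrongSplit P
  subset_part : ∀ X, G.IsStrongSplit X → ∃ P ∈ N, X ⊆ P ∨ Xᶜ ⊆ P
  compl_notMem : ∀ X ∈ N, G.IsStrongSplit X → Xᶜ ∉ N

section Nodes

variable {V : Type*} {G : SimpleGraph V} {D : MarkedDecomposition V} {K : SplitComponent V}
  {X Y : Set V} {M N : Set (Set V)}

/-- A node is determined by any one of its parts. The common part `Y` makes each partition refine
the other: if a part `P ≠ Y` of `M` had only its complement inside a part of `N`, that part would be
`Y`, so `Y = Pᶜ`, which `compl_notMem` forbids. -/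
lemma SimpleGraph.IsNode.subset (hM : G.IsNode M) (hN : G.IsNode N)
    (hYM : Y ∈ M) (hYN : Y ∈ N) : M ⊆ N := by
  have key : ∀ M N, G.IsNode M → G.IsNode N → Y ∈ M → Y ∈ N → ∀ P ∈ M, ∃ Q ∈ N, P ⊆ Q := by
    intro M N hM hN hYM hYN P hP
    rcases hM.singleton_or_strong P hP with ⟨v, rfl⟩ | hPs
    · obtain ⟨Q, hQ, hv⟩ := hN.cover v
      exact ⟨Q, hQ, Set.singleton_subset_iff.2 hv⟩
    · obtain ⟨Q, hQ, h | h⟩ := hN.subset_part P hPs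
      · exact ⟨Q, hQ, h⟩
      · by_cases e : P = Y
        · exact ⟨Y, hYN, e.le⟩
        exfalso
        have hsub : Y ⊆ Pᶜ := fun v hv hvP => e (hM.eq_of_mem P hP Y hYM v hvP hv)
        obtain ⟨y, hy⟩ := hM.nonempty Y hYM
        obtain rfl := hN.eq_of_mem Y hYN Q hQ y hy (h (hsub hy))
        exact hM.compl_notMem P hP hPs (subset_antisymm h hsub ▸ hYM)
  intro P hP
  obtain ⟨Q, hQ, hPQ⟩ := key M N hM hN hYM hYN P hP
  obtain ⟨P', hP', hQP'⟩ := key N M hN hM hYN hYM Q hQ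
  obtain ⟨v, hv⟩ := hM.nonempty P hP
  obtain rfl := hM.eq_of_mem P hP P' hP' v hv (hQP' (hPQ hv))
  rwa [subset_antisymm hPQ hQP']

lemma IsSplitDecomposition.components_eq (h : IsSplitDecomposition G D)
    (he : D.specialEdges = ∅) : D.components = {G.toSplitComponent} := by
  cases h with
  | base => rfl
  | step => exact absurd he (Set.insert_nonempty _ _).ne_empty

namespace IsSkeleton

variable [Finite V]

lemma isNode (h : IsSkeleton G D) (hG : G.IsPrimeGraph) (hK : K ∈ D.components) :
    G.IsNode K.verts := by
  have hD := h.isTreeLike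
  have hQ := hD.isQuotient K hK
  exact
    { nonempty := hQ.nonempty
      cover := hQ.cover
      eq_of_mem := hQ.eq_of_mem
      singleton_or_strong := fun P hP =>
        (hD.singleton_or_side K hK P hP).imp_right fun h' => (h.mem_sides_iff hG).1 h'
      subset_part := fun X hX => hD.subset_vertex X ((h.mem_sides_iff hG).2 hX) K hK
      compl_notMem := fun X hXK hX => hD.compl_notMem X ((h.mem_sides_iff hG).2 hX) K hK hXK }

lemma exists_component_of_isNode (h : IsSkeleton G D) (hG : G.IsPrimeGraph) (hN : G.IsNode N) :
    ∃ K ∈ D.components, K.verts = N := by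
  have hD := h.isTreeLike
  by_cases hY : ∃ Y ∈ N, G.IsStrongSplit Y
  · obtain ⟨Y, hYN, hY⟩ := hY
    obtain ⟨K, hK, hYK⟩ := hD.exists_component Y ((h.mem_sides_iff hG).2 hY)
    exact ⟨K, hK, subset_antisymm ((h.isNode hG hK).subset hN hYK hYN)
      (hN.subset (h.isNode hG hK) hYN hYK)⟩
  -- With only singletons as parts there is no strong split at all, hence no special edge, and the
  -- decomposition is `G` itself.
  · push Not at hY
    have hsing : ∀ P ∈ N, ∃ v, P = {v} := fun P hP =>
      (hN.singleton_or_strong P hP).resolve_right (hY P hP)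
    have hno : ∀ X, ¬ G.IsStrongSplit X := by
      intro X hX
      obtain ⟨P, hP, hXP⟩ := hN.subset_part X hX
      obtain ⟨v, rfl⟩ := hsing P hP
      rcases hXP with e | e
      · exact Set.not_nontrivial_singleton (hX.nontrivial.mono e)
      · exact Set.not_nontrivial_singleton (hX.compl_nontrivial.mono e)
    have hempty : D.specialEdges = ∅ := by
      rw [Set.eq_empty_iff_forall_notMem]
      rintro ⟨X, Y⟩ hXY
      obtain rfl := hD.eq_compl X Y hXY
      exact hno X ((h.mem_sides_iff hG).1 (Or.inl hXY))
    refine ⟨G.toSplitComponent, ?_, ?_⟩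
    · rw [h.isSplitDecomposition.components_eq hempty]
      rfl
    · refine subset_antisymm ?_ ?_
      · rintro _ ⟨v, rfl⟩
        obtain ⟨P, hP, hv⟩ := hN.cover v
        obtain ⟨w, rfl⟩ := hsing P hP
        obtain rfl := hv
        exact hP
      · intro P hP
        obtain ⟨v, rfl⟩ := hsing P hP
        exact ⟨v, rfl⟩

end IsSkeleton

lemma IsQuotient.isCompleteComponent_iff (hK : IsQuotient G K) :
    K.IsCompleteComponent ↔ ∀ P ∈ K.verts, ∀ Q ∈ K.verts, P ≠ Q → G.Touches P Q :=
  forall₂_congr fun P hP => forall₂_congr fun Q hQ => by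
    simp +contextual [hK.adj_iff, hP, hQ]

lemma IsQuotient.isStarWithCenter_iff (hK : IsQuotient G K) {c : Set V} :
    K.IsStarWithCenter c ↔ c ∈ K.verts ∧ ∀ P ∈ K.verts, ∀ Q ∈ K.verts,
      (P ≠ Q ∧ G.Touches P Q ↔ P ≠ Q ∧ (P = c ∨ Q = c)) :=
  and_congr_right fun _ => forall₂_congr fun P hP => forall₂_congr fun Q hQ => by
    simp [hK.adj_iff, hP, hQ]

/-! ### An intrinsic description of the labelings -/

/-- The vertex sets whose bilabelings are canonical. -/
def SimpleGraph.canonicalSets (G : SimpleGraph V) : Set (Set V) :=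
  {X | (∃ v : V, X = {v}) ∨
    (∃ v : V, X = {x | x ∈ G.neighborSet v ∧ G.closedNbhd x ⊆ G.closedNbhd v}) ∨
    (∃ N, G.IsNode N ∧ (∀ P ∈ N, ∀ Q ∈ N, P ≠ Q → G.Touches P Q) ∧
      X = ⋃ P ∈ N, G.represented P) ∨
    (∃ N, G.IsNode N ∧ ∃ c, (c ∈ N ∧ ∀ P ∈ N, ∀ Q ∈ N,
      (P ≠ Q ∧ G.Touches P Q ↔ P ≠ Q ∧ (P = c ∨ Q = c))) ∧ IsMarker c ∧ X = G.represented c)}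

/-- The trilabeling belonging to the bipartition `(X, Xᶜ)`. -/
noncomputable def SimpleGraph.splitLabeling (G : SimpleGraph V) (X : Set V) : V → ℕ :=
  trilabeling (frontierPart G.Adj X Xᶜ) (frontierPart G.Adj Xᶜ X)

/-- The skeleton enters the right-hand side only through the special edges, of which only the order
of the two sides is a choice. -/
lemma IsSkeleton.mem_labSet_iff [Finite V] (h : IsSkeleton G D) (hG : G.IsPrimeGraph)
    {l : V → ℕ} : l ∈ labSet G D ↔ (∃ X ∈ G.canonicalSets, l = bilabeling X) ∨
      ∃ X, (X, Xᶜ) ∈ D.specialEdges ∧ l = G.splitLabeling X := by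
  have hD := h.isTreeLike
  constructor
  · rintro ((((⟨v, rfl⟩ | ⟨v, rfl⟩) | ⟨X, Y, hXY, rfl⟩) | ⟨K, hK, hc, rfl⟩) |
      ⟨K, hK, c, hc, hm, rfl⟩)
    · exact Or.inl ⟨_, Or.inl ⟨v, rfl⟩, rfl⟩
    · exact Or.inl ⟨_, Or.inr (Or.inl ⟨v, rfl⟩), rfl⟩
    · obtain rfl := hD.eq_compl X Y hXY
      exact Or.inr ⟨X, hXY, rfl⟩
    · exact Or.inl ⟨_, Or.inr (Or.inr (Or.inl ⟨K.verts, h.isNode hG hK,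
        (hD.isQuotient K hK).isCompleteComponent_iff.1 hc, rfl⟩)), rfl⟩
    · exact Or.inl ⟨_, Or.inr (Or.inr (Or.inr ⟨K.verts, h.isNode hG hK, c,
        (hD.isQuotient K hK).isStarWithCenter_iff.1 hc, hm, rfl⟩)), rfl⟩
  · rintro (⟨_, ⟨v, rfl⟩ | ⟨v, rfl⟩ | ⟨N, hN, hc, rfl⟩ | ⟨N, hN, c, hc, hm, rfl⟩, rfl⟩ |
      ⟨X, hX, rfl⟩)
    · exact Or.inl (Or.inl (Or.inl (Or.inl ⟨v, rfl⟩)))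
    · exact Or.inl (Or.inl (Or.inl (Or.inr ⟨v, rfl⟩)))
    · obtain ⟨K, hK, rfl⟩ := h.exists_component_of_isNode hG hN
      exact Or.inl (Or.inr ⟨K, hK, (hD.isQuotient K hK).isCompleteComponent_iff.2 hc, rfl⟩)
    · obtain ⟨K, hK, rfl⟩ := h.exists_component_of_isNode hG hN
      exact Or.inr ⟨K, hK, c, (hD.isQuotient K hK).isStarWithCenter_iff.2 hc, hm, rfl⟩
    · exact Or.inl (Or.inl (Or.inr ⟨X, _, hX, rfl⟩))

/-! ### Trilabelings and the order of the sides -/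

lemma bilabeling_ne_three (X : Set V) (v : V) : bilabeling X v ≠ 3 := by
  unfold bilabeling
  split_ifs <;> decide

lemma trilabeling_eq_one_iff {S T : Set V} {v : V} : trilabeling S T v = 1 ↔ v ∈ S := by
  unfold trilabeling
  split_ifs <;> simp [*]

lemma trilabeling_eq_two_iff {S T : Set V} (hST : Disjoint S T) {v : V} :
    trilabeling S T v = 2 ↔ v ∈ T := by
  unfold trilabeling
  split_ifs with h1 h2
  · simp [Set.disjoint_left.1 hST h1]
  · simp [h2]
  · simp [h2]

lemma disjoint_frontierPart (X : Set V) :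
    Disjoint (frontierPart G.Adj X Xᶜ) (frontierPart G.Adj Xᶜ X) :=
  disjoint_compl_right.mono (fun _ h => h.1) fun _ h => h.1

/-- Exchanging the sides of a split exchanges the labels `1` and `2`. -/
lemma swap_comp_splitLabeling (X : Set V) :
    Equiv.swap 1 2 ∘ G.splitLabeling X = G.splitLabeling Xᶜ := by
  have hd := Set.disjoint_left.1 (disjoint_frontierPart (G := G) X)
  rw [SimpleGraph.splitLabeling, SimpleGraph.splitLabeling, compl_compl]
  funext v
  simp only [Function.comp, trilabeling]
  by_cases h1 : v ∈ frontierPart G.Adj X Xᶜ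
  · simp [h1, hd h1]
  · by_cases h2 : v ∈ frontierPart G.Adj Xᶜ X
    · simp [h1, h2]
    · simp only [h1, h2, if_false]
      rfl

/-- In a connected graph a strong split is determined by its frontiers. -/
lemma SimpleGraph.IsStrongSplit.eq_of_splitLabeling_eq (hG : G.CutConnected)
    (hX : G.IsStrongSplit X) (hY : G.IsStrongSplit Y)
    (h : G.splitLabeling X = G.splitLabeling Y) : X = Y := by
  have e1 : frontierPart G.Adj X Xᶜ = frontierPart G.Adj Y Yᶜ := by
    ext v
    rw [← trilabeling_eq_one_iff, ← trilabeling_eq_one_iff]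
    exact Iff.of_eq (congrArg (· = 1) (congrFun h v))
  have e2 : frontierPart G.Adj Xᶜ X = frontierPart G.Adj Yᶜ Y := by
    ext v
    rw [← trilabeling_eq_two_iff (disjoint_frontierPart X),
      ← trilabeling_eq_two_iff (disjoint_frontierPart Y)]
    exact Iff.of_eq (congrArg (· = 2) (congrFun h v))
  -- If `Y ∩ Xᶜ` were nonempty, an edge would leave it. Its inner endpoint would then be in a
  -- frontier of one split and on the wrong side for the equal frontier of the other.
  have key : ∀ X Y : Set V, X.Nonempty → frontierPart G.Adj X Xᶜ = frontierPart G.Adj Y Yᶜ →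
      frontierPart G.Adj Xᶜ X = frontierPart G.Adj Yᶜ Y → Y ∩ Xᶜ = ∅ := by
    intro X Y ⟨x, hx⟩ e1 e2
    by_contra hne
    obtain ⟨a, ha, b, hb, hab⟩ := hG (Y ∩ Xᶜ) (Set.nonempty_iff_ne_empty.2 hne)
      ⟨x, fun h => h.2 hx⟩
    by_cases hbX : b ∈ X
    · exact (e2 ▸ (⟨ha.2, b, hbX, hab⟩ : a ∈ frontierPart G.Adj Xᶜ X) :
        a ∈ frontierPart G.Adj Yᶜ Y).1 ha.1
    · have hbY : b ∈ Yᶜ := fun hbY => hb ⟨hbY, hbX⟩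
      exact ha.2 (e1.symm ▸ (⟨ha.1, b, hbY, hab⟩ : a ∈ frontierPart G.Adj Y Yᶜ) :
        a ∈ frontierPart G.Adj X Xᶜ).1
  have h1 := key X Y hX.nontrivial.nonempty e1 e2
  have h2 := key Y X hY.nontrivial.nonempty e1.symm e2.symm
  rw [← Set.sdiff_eq, Set.sdiff_eq_empty] at h1 h2
  exact subset_antisymm h2 h1

/-- In a prime graph the trilabeling of a proper split uses the third label. -/
lemma SimpleGraph.IsStrongSplit.exists_splitLabeling_eq_three (hG : G.IsPrimeGraph)
    (hX : G.IsStrongSplit X) : ∃ v, G.splitLabeling X v = 3 := by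
  by_contra hno
  have hv : ∀ v, v ∈ frontierPart G.Adj X Xᶜ ∨ v ∈ frontierPart G.Adj Xᶜ X := by
    intro v
    by_contra hv
    rw [not_or] at hv
    exact hno ⟨v, by simp [splitLabeling, trilabeling, hv.1, hv.2]⟩
  -- If the frontiers exhaust `V`, the two sides are completely joined and `X` is a nontrivial
  -- module.
  have hadj : ∀ a ∈ X, ∀ b ∉ X, G.Adj a b := by
    intro a ha b hb
    obtain ⟨-, b', hb', hab⟩ := (hv a).resolve_right fun h => h.1 ha
    obtain ⟨-, a', ha', hba⟩ := (hv b).resolve_left fun h => hb h.1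
    exact hX.isSplitSet a ha a' ha' b' hb' b hb hab hba.symm
  rcases hG X hX.nontrivial.nonempty fun x hx y hy z hz =>
    iff_of_true (hadj x hx z hz) (hadj y hy z hz) with rfl | ⟨v, rfl⟩
  · obtain ⟨v, hv⟩ := hX.compl_nontrivial.nonempty
    exact hv trivial
  · exact Set.not_nontrivial_singleton hX.nontrivial

/-- A canonical labeling that uses the label `3` does not stay canonical when the labels `1` and
`2` are exchanged. -/
lemma IsSkeleton.swap_comp_notMem_labSet [Finite V] (h : IsSkeleton G D) (hG : G.IsPrimeGraph)
    {l : V → ℕ} (hl : l ∈ labSet G D) (h3 : ∃ v, l v = 3) : Equiv.swap 1 2 ∘ l ∉ labSet G D := by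
  intro hl'
  rw [h.mem_labSet_iff hG] at hl hl'
  obtain ⟨v, hv⟩ := h3
  rcases hl with ⟨X, -, rfl⟩ | ⟨X, hX, rfl⟩
  · exact bilabeling_ne_three X v hv
  rcases hl' with ⟨Y, -, e⟩ | ⟨Y, hY, e⟩
  · refine bilabeling_ne_three Y v ?_
    rw [← e, Function.comp_apply, hv]
    decide
  · rw [swap_comp_splitLabeling] at e
    have hXs := (h.mem_sides_iff hG).1 (Or.inl hX)
    have hYs := (h.mem_sides_iff hG).1 (Or.inl hY)
    obtain rfl := hXs.compl.eq_of_splitLabeling_eq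
      (hG.cutConnected hXs.nontrivial hXs.compl_nontrivial) hYs e
    rw [compl_compl] at hY
    exact h.isTreeLike.asymm _ _ hX hY

end Nodes

/-! ### Invariance under isomorphisms -/

section Transport

variable {V W : Type*} {G : SimpleGraph V} {H : SimpleGraph W} (φ : G ≃g H)

lemma SimpleGraph.Iso.touches_preimage {S T : Set W} :
    G.Touches (φ ⁻¹' S) (φ ⁻¹' T) ↔ H.Touches S T := by
  constructor
  · rintro ⟨u, hu, v, hv, h⟩
    exact ⟨φ u, hu, φ v, hv, φ.map_adj_iff.2 h⟩
  · rintro ⟨u, hu, v, hv, h⟩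
    refine ⟨φ.symm u, by simpa using hu, φ.symm v, by simpa using hv, φ.symm.map_adj_iff.2 h⟩

lemma SimpleGraph.Iso.isSplitSet_preimage {X : Set W} (h : H.IsSplitSet X) :
    G.IsSplitSet (φ ⁻¹' X) := by
  intro a ha a' ha' b hb b' hb' hab hab'
  exact φ.map_adj_iff.1 (h _ ha _ ha' _ hb _ hb' (φ.map_adj_iff.2 hab) (φ.map_adj_iff.2 hab'))

lemma SimpleGraph.Iso.preimage_symm_preimage (X : Set V) : φ ⁻¹' (φ.symm ⁻¹' X) = X := by
  ext v
  simp

lemma SimpleGraph.Iso.symm_preimage_preimage (X : Set W) : φ.symm ⁻¹' (φ ⁻¹' X) = X := by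
  ext v
  simp

lemma SimpleGraph.Iso.nontrivial_preimage {X : Set W} (h : X.Nontrivial) :
    (φ ⁻¹' X).Nontrivial := h.preimage φ.surjective

lemma SimpleGraph.Iso.isStrongSplit_preimage {X : Set W} (h : H.IsStrongSplit X) :
    G.IsStrongSplit (φ ⁻¹' X) where
  isSplitSet := φ.isSplitSet_preimage h.isSplitSet
  nontrivial := φ.nontrivial_preimage h.nontrivial
  compl_nontrivial := φ.nontrivial_preimage h.compl_nontrivial
  not_crosses Z hZ hc := by
    refine h.not_crosses _ (φ.symm.isSplitSet_preimage hZ) ?_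
    obtain ⟨⟨a, ha⟩, ⟨b, hb⟩, ⟨c, hc⟩, ⟨d, hd⟩⟩ := hc
    exact ⟨⟨φ a, by simpa using ha⟩, ⟨φ b, by simpa using hb⟩, ⟨φ c, by simpa using hc⟩,
      ⟨φ d, by simpa using hd⟩⟩

lemma SimpleGraph.Iso.preimage_singleton (w : W) : φ ⁻¹' {w} = {φ.symm w} := by
  ext v
  simp [φ.eq_symm_apply]

lemma SimpleGraph.Iso.frontierPart_preimage (X Y : Set W) :
    frontierPart G.Adj (φ ⁻¹' X) (φ ⁻¹' Y) = φ ⁻¹' frontierPart H.Adj X Y := by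
  ext v
  refine and_congr_right fun _ => ?_
  constructor
  · rintro ⟨u, hu, h⟩
    exact ⟨φ u, hu, φ.map_adj_iff.2 h⟩
  · rintro ⟨u, hu, h⟩
    exact ⟨φ.symm u, by simpa using hu, φ.map_adj_iff.1 (by simpa using h)⟩

lemma SimpleGraph.Iso.represented_preimage (P : Set W) :
    G.represented (φ ⁻¹' P) = φ ⁻¹' H.represented P := by
  have : {v | φ ⁻¹' P = {v}} = φ ⁻¹' {w | P = {w}} := by
    ext v
    have : ({v} : Set V) = φ ⁻¹' {φ v} := by simp [φ.preimage_singleton]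
    simp only [Set.mem_ofPred_eq, Set.mem_preimage]
    rw [this, (Set.preimage_injective.2 φ.surjective).eq_iff]
  rw [represented, represented, Set.preimage_union, ← this, ← φ.frontierPart_preimage]
  rfl

lemma SimpleGraph.Iso.isNode_image_preimage {N : Set (Set W)} (h : H.IsNode N) :
    G.IsNode ((fun P => φ ⁻¹' P) '' N) where
  nonempty := by
    rintro _ ⟨P, hP, rfl⟩
    exact (h.nonempty P hP).preimage φ.surjective
  cover v := by
    obtain ⟨P, hP, hv⟩ := h.cover (φ v)
    exact ⟨_, ⟨P, hP, rfl⟩, hv⟩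
  eq_of_mem := by
    rintro _ ⟨P, hP, rfl⟩ _ ⟨Q, hQ, rfl⟩ v hv hv'
    rw [h.eq_of_mem P hP Q hQ (φ v) hv hv']
  singleton_or_strong := by
    rintro _ ⟨P, hP, rfl⟩
    rcases h.singleton_or_strong P hP with ⟨w, rfl⟩ | hs
    · exact Or.inl ⟨φ.symm w, φ.preimage_singleton w⟩
    · exact Or.inr (φ.isStrongSplit_preimage hs)
  subset_part X hX := by
    obtain ⟨P, hP, e⟩ := h.subset_part _ (φ.symm.isStrongSplit_preimage hX)
    refine ⟨_, ⟨P, hP, rfl⟩, ?_⟩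
    rw [← φ.preimage_symm_preimage X, ← Set.preimage_compl]
    exact e.imp (fun e => Set.preimage_mono e) fun e => Set.preimage_mono e
  compl_notMem := by
    rintro _ ⟨P, hP, rfl⟩ hs ⟨Q, hQ, e⟩
    have hs' := φ.symm.isStrongSplit_preimage hs
    rw [φ.symm_preimage_preimage] at hs'
    rw [← Set.preimage_compl, (Set.preimage_injective.2 φ.surjective).eq_iff] at e
    exact h.compl_notMem P hP hs' (e ▸ hQ)

lemma SimpleGraph.Iso.preimage_mem_canonicalSets {X : Set W} (h : X ∈ H.canonicalSets) :
    φ ⁻¹' X ∈ G.canonicalSets := by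
  have hinj := Set.preimage_injective.2 φ.surjective
  rcases h with ⟨w, rfl⟩ | ⟨w, rfl⟩ | ⟨N, hN, hc, rfl⟩ | ⟨N, hN, c, ⟨hcN, hc⟩, hm, rfl⟩
  · exact Or.inl ⟨φ.symm w, φ.preimage_singleton w⟩
  · refine Or.inr (Or.inl ⟨φ.symm w, ?_⟩)
    have hn : ∀ u, G.closedNbhd u = φ ⁻¹' H.closedNbhd (φ u) := fun u => by
      ext x
      simp [closedNbhd, ← φ.map_adj_iff (v := u)]
    ext x
    have hw : φ (φ.symm w) = w := by simp
    simp only [Set.mem_preimage, Set.mem_ofPred_eq, hn, hw, mem_neighborSet,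
      Set.preimage_subset_preimage_iff (φ.surjective.range_eq ▸ Set.subset_univ _)]
    rw [← φ.map_adj_iff, hw]
  · refine Or.inr (Or.inr (Or.inl ⟨_, φ.isNode_image_preimage hN, ?_, ?_⟩))
    · rintro _ ⟨P, hP, rfl⟩ _ ⟨Q, hQ, rfl⟩ hne
      exact φ.touches_preimage.2 (hc P hP Q hQ fun e => hne (e ▸ rfl))
    · simp [φ.represented_preimage]
  · refine Or.inr (Or.inr (Or.inr ⟨_, φ.isNode_image_preimage hN, φ ⁻¹' c, ⟨⟨c, hcN, rfl⟩, ?_⟩,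
      φ.nontrivial_preimage hm, (φ.represented_preimage c).symm⟩))
    rintro _ ⟨P, hP, rfl⟩ _ ⟨Q, hQ, rfl⟩
    simpa only [φ.touches_preimage, hinj.eq_iff, ne_eq] using hc P hP Q hQ

lemma SimpleGraph.Iso.splitLabeling_comp (X : Set W) :
    H.splitLabeling X ∘ φ = G.splitLabeling (φ ⁻¹' X) := by
  funext v
  simp only [splitLabeling, ← Set.preimage_compl, φ.frontierPart_preimage]
  rfl

variable {D : MarkedDecomposition V} {E : MarkedDecomposition W} [Finite V] [Finite W]

/-- Up to an exchange of the labels `1` and `2` in trilabelings, isomorphisms preserve canonical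
labelings. -/
lemma SimpleGraph.Iso.comp_mem_labSet (hG : G.IsPrimeGraph) (hH : H.IsPrimeGraph)
    (hD : IsSkeleton G D) (hE : IsSkeleton H E) {m : W → ℕ} (hm : m ∈ labSet H E) :
    m ∘ φ ∈ labSet G D ∨ (∃ w, m w = 3) ∧ Equiv.swap 1 2 ∘ m ∘ φ ∈ labSet G D := by
  rw [hE.mem_labSet_iff hH] at hm
  simp only [hD.mem_labSet_iff hG]
  rcases hm with ⟨X, hX, rfl⟩ | ⟨X, hX, rfl⟩
  · exact Or.inl (Or.inl ⟨_, φ.preimage_mem_canonicalSets hX, rfl⟩)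
  · have hXs := (hE.mem_sides_iff hH).1 (Or.inl hX)
    -- The pulled-back strong split is a special edge of `D`, listed in the same or in the opposite
    -- order.
    rcases (hD.mem_sides_iff hG).2 (φ.isStrongSplit_preimage hXs) with e | e
    · exact Or.inl (Or.inr ⟨_, e, φ.splitLabeling_comp X⟩)
    · refine Or.inr ⟨hXs.exists_splitLabeling_eq_three hH, Or.inr ⟨_, by rwa [compl_compl], ?_⟩⟩
      rw [φ.splitLabeling_comp, swap_comp_splitLabeling]

end Transport

/-! ### The bijection of labelings and the theorem -/

/-- Isomorphic prime graphs have equivalent sets of canonical labelings. -/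
lemma SimpleGraph.Iso.labEquivalent {V W : Type*} [Finite V] [Finite W] {G : SimpleGraph V}
    {H : SimpleGraph W} {D : MarkedDecomposition V} {E : MarkedDecomposition W} (φ : G ≃g H)
    (hG : G.IsPrimeGraph) (hH : H.IsPrimeGraph)
    (hD : IsSkeleton G D) (hE : IsSkeleton H E) :
    LabEquivalent G H (labSet G D) (labSet H E) := by
  classical
  have hback : ∀ l : V → ℕ, (l ∘ φ.symm) ∘ φ = l := fun l => by
    funext v
    simp
  have hforth : ∀ m : W → ℕ, (m ∘ φ) ∘ φ.symm = m := fun m => by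
    funext w
    simp
  have hswap : ∀ m : W → ℕ, Equiv.swap 1 2 ∘ Equiv.swap 1 2 ∘ m = m := fun m => by
    funext w
    simp
  have hcan : ∀ l ∈ labSet G D, l ∘ φ.symm ∈ labSet H E ∨
      (∃ v, l v = 3) ∧ Equiv.swap 1 2 ∘ l ∘ φ.symm ∈ labSet H E :=
    fun l hl => φ.symm.comp_mem_labSet hH hG hE hD hl
  -- The relabeling that corrects the transported labeling when the two skeletons list a special
  -- edge in opposite orders.
  let τ : (V → ℕ) → Equiv.Perm ℕ := fun l =>
    if l ∘ φ.symm ∈ labSet H E then Equiv.refl ℕ else Equiv.swap 1 2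
  have hτ : ∀ l ∈ labSet G D, τ l ∘ l ∘ φ.symm ∈ labSet H E := by
    intro l hl
    by_cases h : l ∘ φ.symm ∈ labSet H E
    · simp [τ, h]
    · simpa [τ, h] using ((hcan l hl).resolve_left h).2
  let g : labSet G D → labSet H E := fun l => ⟨τ l.1 ∘ l.1 ∘ φ.symm, hτ l.1 l.2⟩
  -- Otherwise a labeling `l'` using label 3 and its swap `l` would both be canonical for `G`. This
  -- rules out a collision between a swapped and an unswapped image.
  have hmixed : ∀ l ∈ labSet G D, ∀ l' ∈ labSet G D, l' ∘ φ.symm ∉ labSet H E →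
      l ∘ φ.symm ≠ Equiv.swap 1 2 ∘ l' ∘ φ.symm := by
    intro l hl l' hl' hno e
    have e' := congrArg (· ∘ φ) e
    simp only [Function.comp_assoc (Equiv.swap 1 2), hback] at e'
    exact hD.swap_comp_notMem_labSet hG hl' ((hcan l' hl').resolve_left hno).1 (e' ▸ hl)
  have hinj : Function.Injective g := by
    rintro ⟨l, hl⟩ ⟨l', hl'⟩ e
    have e : τ l ∘ l ∘ φ.symm = τ l' ∘ l' ∘ φ.symm := congrArg Subtype.val e
    have hsymm : ∀ {l l' : V → ℕ}, l ∘ φ.symm = l' ∘ φ.symm → l = l' := fun {l l'} e => by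
      rw [← hback l, e, hback]
    refine Subtype.ext ?_
    by_cases h : l ∘ φ.symm ∈ labSet H E <;> by_cases h' : l' ∘ φ.symm ∈ labSet H E <;>
      simp only [τ, h, h', if_true, if_false, Equiv.coe_refl, Function.id_comp] at e
    · exact hsymm e
    · exact absurd e (hmixed l hl l' hl' h')
    · exact absurd e.symm (hmixed l' hl' l hl h)
    · exact hsymm ((Equiv.swap 1 2).injective.comp_left e)
  have hsurj : Function.Surjective g := by
    rintro ⟨m, hm⟩
    rcases φ.comp_mem_labSet hG hH hD hE hm with h | ⟨h3, h⟩
    · refine ⟨⟨_, h⟩, Subtype.ext ?_⟩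
      change τ _ ∘ _ = m
      simp only [τ, hforth, hm, if_true, Equiv.coe_refl, Function.id_comp]
    · refine ⟨⟨_, h⟩, Subtype.ext ?_⟩
      change τ _ ∘ _ = m
      simp only [τ, Function.comp_assoc (Equiv.swap 1 2), hforth,
        hE.swap_comp_notMem_labSet hH hm h3, if_false, hswap]
  refine ⟨Equiv.ofBijective g ⟨hinj, hsurj⟩, fun l => ⟨φ, ((τ l.1).image (Set.range l.1)).trans
    (Equiv.setCongr ?_), fun v => ?_⟩⟩
  · change _ = Set.range (τ l.1 ∘ l.1 ∘ φ.symm)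
    rw [Set.range_comp, φ.symm.surjective.range_comp]
  · change τ l.1 (l.1 v) = τ l.1 (l.1 (φ.symm (φ v)))
    simp

/-- An equivalence yields an isomorphism only through some labeling. On the empty vertex set it
comes from a component, which is vacuously complete. -/
lemma IsSkeleton.labSet_nonempty {V : Type*} {G : SimpleGraph V} {D : MarkedDecomposition V}
    (h : IsSkeleton G D) : (labSet G D).Nonempty := by
  rcases isEmpty_or_nonempty V with hV | ⟨⟨v⟩⟩
  · obtain ⟨K, hK⟩ := h.isTreeLike.components_nonempty
    refine ⟨_, Or.inl (Or.inr ⟨K, hK, fun P hP => ?_, rfl⟩)⟩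
    exact isEmptyElim ((h.isTreeLike.isQuotient K hK).nonempty P hP).some
  · exact ⟨_, Or.inl (Or.inl (Or.inl (Or.inl ⟨v, rfl⟩)))⟩

theorem mainTheorem5 {V W : Type*} [Finite V] [Finite W]
    (G : SimpleGraph V) (H : SimpleGraph W)
    (hG : G.IsPrimeGraph) (hH : H.IsPrimeGraph)
    (D : MarkedDecomposition V) (hD : IsSkeleton G D)
    (E : MarkedDecomposition W) (hE : IsSkeleton H E) :
    LabEquivalent G H (labSet G D) (labSet H E) ↔ Nonempty (G ≃g H) := by
  constructor
  · rintro ⟨g, hg⟩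
    obtain ⟨l, hl⟩ := hD.labSet_nonempty
    obtain ⟨f, -⟩ := hg ⟨l, hl⟩
    exact ⟨f⟩
  · rintro ⟨φ⟩
    exact φ.labEquivalent hG hH hD hE
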